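/- Call a real $d\times d$ matrix $M$ \emph{expanding} if all of its (complex) eigenvalues are larger than one in absolute value. A nonempty compact set $G\subset\mathbb{R}^d$ is an \emph{attractor} if there exist an expanding matrix $M\in\mathbb{R}^{d\times d}$ and a set $S\subset\mathbb{R}^d$ of vectors such that $G=\bigcup_{s\in S}M^{-1}(G+s)$ and, for any two distinct $s,t\in S$, the intersection $M^{-1}(G+s)\cap M^{-1}(G+t)$ has Lebesgue measure zero. A \emph{plane polygon} is a compact set $G\subset\mathbb{R}^2$ (not necessarily convex) that is bounded by a simple closed broken line, i.e. the union of a simple closed broken line and the bounded component of its complement. \textbf{Theorem.} If a plane polygon $G\subset\mathbb{R}^2$ is an attractor, then $G$ is a (nondegenerate) parallelogram. -/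

import Mathlib

open Set MeasureTheory

/-- A real square matrix is expanding if every complex eigenvalue of it has absolute value
larger than one. -/
def IsExpanding {d : ℕ} (M : Matrix (Fin d) (Fin d) ℝ) : Prop :=
  ∀ z ∈ spectrum ℂ (M.map (algebraMap ℝ ℂ)), 1 < ‖z‖

/-- The copy `M⁻¹ (G + s)` of the set `G`. -/
def contractedCopy {d : ℕ} (M : Matrix (Fin d) (Fin d) ℝ) (G : Set (Fin d → ℝ))
    (s : Fin d → ℝ) : Set (Fin d → ℝ) :=
  (fun x => M⁻¹.mulVec (x + s)) '' G

/-- A nonempty compact set `G ⊆ ℝᵈ` is an attractor if, for some expanding real matrix `M` and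
some set `S` of vectors, `G` is the union of the copies `M⁻¹ (G + s)`, `s ∈ S`, and any two of
these copies have an intersection of Lebesgue measure zero. -/
def IsAttractor {d : ℕ} (G : Set (Fin d → ℝ)) : Prop :=
  G.Nonempty ∧ IsCompact G ∧
    ∃ (M : Matrix (Fin d) (Fin d) ℝ) (S : Set (Fin d → ℝ)),
      IsExpanding M ∧
      G = ⋃ s ∈ S, contractedCopy M G s ∧
      ∀ s ∈ S, ∀ t ∈ S, s ≠ t → volume (contractedCopy M G s ∩ contractedCopy M G t) = 0

/-- A closed broken line with vertices `p 0, …, p (n - 1)` is simple if it has at least three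
edges, no edge is a point, two consecutive edges (the last one is followed by the first one) have
only their common vertex in common, and two edges that are not consecutive are disjoint. -/
structure IsSimpleClosedBrokenLine {n : ℕ} (p : Polygon (Fin 2 → ℝ) n) : Prop where
  three_le : 3 ≤ n
  nondegenerate : p.HasNondegenerateEdges
  consecutive : ∀ i : Fin n,
    p.edgeSet ℝ i ∩ p.edgeSet ℝ (finRotate n i) = {p (finRotate n i)}
  disjoint : ∀ i j : Fin n, i ≠ j → j ≠ finRotate n i → i ≠ finRotate n j →
    Disjoint (p.edgeSet ℝ i) (p.edgeSet ℝ j)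

/-- A plane polygon, as a figure: a compact set that is the closure of its connected nonempty
interior and whose topological boundary is a simple closed broken line. By the Jordan curve
theorem, this is the union of the broken line and the bounded component of its complement. -/
structure IsPlanePolygon (G : Set (Fin 2 → ℝ)) : Prop where
  compact : IsCompact G
  connected_interior : IsConnected (interior G)
  closure_interior : closure (interior G) = G
  boundary : ∃ (n : ℕ) (p : Polygon (Fin 2 → ℝ) n),
    IsSimpleClosedBrokenLine p ∧ frontier G = p.boundary ℝ

/-- A nondegenerate parallelogram `{a + x u + y v : 0 ≤ x, y ≤ 1}`. -/
def IsParallelogram (G : Set (Fin 2 → ℝ)) : Prop :=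
  ∃ a u v : Fin 2 → ℝ, LinearIndependent ℝ ![u, v] ∧
    G = (fun x => a + x) '' parallelepiped ![u, v]

/-!
Blowing a polygonal attractor `G` up by its expanding matrix gives a set that is tiled by finitely
many translates of `G` (`IsAttractor.exists_isTiling`), and this remains true for all powers of the
matrix (`IsTiling.comp`). The image of an edge is covered by edges of tiles, so the matrix permutes
the finitely many directions of edges, and a power `A` of it has eigenvalues larger than one in all
these directions (`IsPolygonal.exists_parallel`, `exists_pow_eigenvector`,
`IsExpanding.one_lt_abs`). Such a map leaves the tangent cone of `G` at each of its points
invariant, because it does not move vectors across the lines that bound the cone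
(`IsPolygonal.map_mem_germCone`).

A farthest point of `G` from the origin has a tangent cone that lies in an open half-plane `ν > 0`,
except for its apex. Only finitely many points of `G` have this property, for the same `ν`
(`IsPolygonal.finite_pointedAt`), and a tile that contains such a point `z` has in its place another
such point, as the tangent cone of the tile is contained in that of `G`. So there is a periodic
point (`IsPolygonal.exists_periodic_point`): after passing to a power of `A`, the blow-up of `G` at
`z` contains `G` itself as a tile. Since `A` is expanding, `G` is contained in its tangent cone at
`z` (`IsPolygonal.sub_mem_germCone`). This cone is the angle between two rays parallel to edges,
since the interior of `G` is connected (`IsPolygonal.exists_germCone_eq`).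

In coordinates in which the angle is the first quadrant, `A` is diagonal, and the quadrant is tiled
by translates of `G`, among them `G` itself (`IsCornerTile`). Let `(f, 0)` be the last point of `G`
on the horizontal axis. A path in `G` from the origin to `(f, 0)` and its translate by `(c, 0)`,
where `0 < c < f`, have alternating end points on the boundary of the upper half-plane, so they cross
(`exists_eq_of_alternating_endpoints`), and `G + (c, 0)` is not a tile. Therefore the segment from
the origin to `(f, 0)` is a side of `G`, the next tile along the axis is `G + (f, 0)`, and `G` lies
to the left of the vertical line through `(f, 0)` (`IsCornerTile.fst_le`). The same holds for the
other axis, with a side that ends at `(0, g)`. Finally, a tile `G + (x, y)` with `0 < x < f` and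
`0 < y < g` would overlap the tile `G + (f, 0)` where its bottom side meets the left side of the
latter, so that the rectangle with the sides `f` and `g` contains no gap
(`IsCornerTile.exists_eq_prod`).
-/

/-! ### Crossing paths in a half-plane -/

/-- Along a path that avoids a ray from the origin, every continuous logarithm changes by as much
as the principal branch rotated away from this ray. -/
theorem log_lift_sub_eq {g h : ℝ → ℂ} {w : ℂ} (hg : Continuous g) (hh : Continuous h)
    (hexp : ∀ s, Complex.exp (g s) = h s) (hw : ∀ s, w * h s ∈ Complex.slitPlane) :
    g 1 - g 0 = Complex.log (w * h 1) - Complex.log (w * h 0) := by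
  have hne : ∀ s, w * h s ≠ 0 := fun s => Complex.slitPlane_ne_zero (hw s)
  have hw0 : w ≠ 0 := left_ne_zero_of_mul (hne 0)
  have hh0 : ∀ s, h s ≠ 0 := fun s => right_ne_zero_of_mul (hne s)
  have hc : Continuous fun s => Complex.log (w * h s) + (g 0 - Complex.log (w * h 0)) :=
    ((continuous_const.mul hh).clog hw).add continuous_const
  have := Complex.isCoveringMap_exp.eq_of_comp_eq hg hc (by
    funext s
    refine Subtype.ext ?_
    change Complex.exp (g s) = Complex.exp (Complex.log (w * h s) + (g 0 - Complex.log (w * h 0)))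
    rw [Complex.exp_add, Complex.exp_sub, Complex.exp_log (hne s), Complex.exp_log (hne 0),
      hexp, hexp]
    field_simp [hw0, hh0 0]) 0 (by simp)
  rw [congrFun this 1]
  ring

/-- Two paths in the closed upper half-plane whose end points alternate on the real line meet. -/
theorem exists_eq_of_alternating_endpoints {γ δ : ℝ → ℂ} (hγ : Continuous γ) (hδ : Continuous δ)
    (hγi : ∀ s, 0 ≤ (γ s).im) (hδi : ∀ s, 0 ≤ (δ s).im) {a b c d : ℝ}
    (hac : a < c) (hcb : c < b) (hbd : b < d)
    (hγ0 : γ 0 = a) (hγ1 : γ 1 = b) (hδ0 : δ 0 = c) (hδ1 : δ 1 = d) :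
    ∃ s t, γ s = δ t := by
  by_contra! hne
  -- A continuous logarithm of `γ s - δ t` would change by different amounts along the two
  -- ways around the unit square.
  obtain ⟨L, hLc, hL⟩ := Complex.exists_continuousOn_eqOn_exp_comp (X := ℝ × ℝ) (U := univ)
    (by
      have := (convex_univ (𝕜 := ℝ) (E := ℝ × ℝ)).contractibleSpace univ_nonempty
      exact SimplyConnectedSpace.ofContractible _) isOpen_univ
    (g := fun p => γ p.1 - δ p.2) (by fun_prop) (by
      rintro ⟨p, -, hp⟩
      exact hne _ _ (sub_eq_zero.1 hp))
  have hLc : Continuous L := by simpa [continuousOn_univ] using hLc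
  have hexp : ∀ s t, Complex.exp (L (s, t)) = γ s - δ t := fun s t => hL (mem_univ (s, t))
  have up : ∀ z : ℂ, z ≠ 0 → 0 ≤ z.im → -Complex.I * z ∈ Complex.slitPlane := by
    intro z hz him
    rw [Complex.mem_slitPlane_iff]
    by_cases h : z.im = 0
    · right
      simpa using fun h' => hz (Complex.ext h' h)
    · left
      simpa using lt_of_le_of_ne him (Ne.symm h)
  have dn : ∀ z : ℂ, z ≠ 0 → z.im ≤ 0 → Complex.I * z ∈ Complex.slitPlane := by
    intro z hz him
    simpa using up (-z) (neg_ne_zero.2 hz) (by simpa using him)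
  have hp : ∀ (x : ℝ) (w : ℂ), 0 < x → (Complex.log (w * x)).im = w.arg := by
    intro x w hx
    rw [Complex.log_im, mul_comm, Complex.arg_real_mul _ hx]
  have hn : ∀ (x : ℝ) (w : ℂ), x < 0 → (Complex.log (w * x)).im = (-w).arg := by
    intro x w hx
    have := hp (-x) (-w) (by linarith)
    simpa using this
  -- The differences are in the upper half-plane on the horizontal sides of the square and in the
  -- lower half-plane on the vertical sides.
  have e1 := log_lift_sub_eq (g := fun s => L (s, 0)) (h := fun s => γ s - δ 0)
    (w := -Complex.I) (by fun_prop) (by fun_prop) (fun s => hexp s 0)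
    (fun s => up _ (sub_ne_zero.2 (hne _ _)) (by simp [hδ0, hγi]))
  have e2 := log_lift_sub_eq (g := fun s => L (1, s)) (h := fun s => γ 1 - δ s)
    (w := Complex.I) (by fun_prop) (by fun_prop) (fun s => hexp 1 s)
    (fun s => dn _ (sub_ne_zero.2 (hne _ _)) (by simp [hγ1, hδi]))
  have e3 := log_lift_sub_eq (g := fun s => L (0, s)) (h := fun s => γ 0 - δ s)
    (w := Complex.I) (by fun_prop) (by fun_prop) (fun s => hexp 0 s)
    (fun s => dn _ (sub_ne_zero.2 (hne _ _)) (by simp [hγ0, hδi]))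
  have e4 := log_lift_sub_eq (g := fun s => L (s, 1)) (h := fun s => γ s - δ 1)
    (w := -Complex.I) (by fun_prop) (by fun_prop) (fun s => hexp s 1)
    (fun s => up _ (sub_ne_zero.2 (hne _ _)) (by simp [hδ1, hγi]))
  simp only [hγ0, hγ1, hδ0, hδ1, ← Complex.ofReal_sub] at e1 e2 e3 e4
  have f1 := congrArg Complex.im e1
  have f2 := congrArg Complex.im e2
  have f3 := congrArg Complex.im e3
  have f4 := congrArg Complex.im e4
  rw [Complex.sub_im, Complex.sub_im, hp _ _ (by linarith), hn _ _ (by linarith), neg_neg,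
    Complex.arg_neg_I, Complex.arg_I] at f1
  rw [Complex.sub_im, Complex.sub_im, hn _ _ (by linarith), hp _ _ (by linarith),
    Complex.arg_neg_I, Complex.arg_I] at f2
  rw [Complex.sub_im, Complex.sub_im, hn _ _ (by linarith), hn _ _ (by linarith), sub_self] at f3
  rw [Complex.sub_im, Complex.sub_im, hn _ _ (by linarith), hn _ _ (by linarith), sub_self] at f4
  have := Real.pi_pos
  linarith

/-! ### Tilings of a blow-up by translates -/

theorem ContinuousLinearEquiv.pow_apply_eq_smul {E : Type*} [NormedAddCommGroup E]
    [NormedSpace ℝ E] {A : E ≃L[ℝ] E} {v : E} {r : ℝ} (h : A v = r • v) (k : ℕ) :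
    (A ^ k : E ≃L[ℝ] E) v = r ^ k • v := by
  induction k with
  | zero => rw [pow_zero, pow_zero, one_smul]; rfl
  | succ k ih =>
    rw [pow_succ]
    change (A ^ k : E ≃L[ℝ] E) (A v) = _
    rw [h, map_smul, ih, smul_smul, pow_succ']

/-- The set `G` is blown up by the map `A` onto the union of its translates `G + s`, `s ∈ S`,
where `S` is finite and the interiors of distinct translates are disjoint. -/
structure IsTiling {E : Type*} [NormedAddCommGroup E] (A : E → E) (G S : Set E) : Prop where
  finite : S.Finite
  translate_subset : ∀ s ∈ S, ∀ x ∈ G, ∃ z ∈ G, A z = x + s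
  subset_translates : ∀ z ∈ G, ∃ s ∈ S, ∃ x ∈ G, A z = x + s
  eq_of_interior : ∀ s ∈ S, ∀ t ∈ S, ∀ x ∈ interior G, ∀ y ∈ interior G, x + s = y + t → s = t

section comp

variable {E : Type*} [NormedAddCommGroup E] [NormedSpace ℝ E] {G S T : Set E} {A B : E ≃L[ℝ] E}

theorem IsTiling.mem_interior (h : IsTiling A G S) {s x z : E} (hs : s ∈ S)
    (hx : x ∈ interior G) (hz : A z = x + s) : z ∈ interior G := by
  have ho : IsOpen ((fun z => A z - s) ⁻¹' interior G) :=
    isOpen_interior.preimage (by fun_prop)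
  refine interior_maximal ?_ ho (a := z) (by simpa [hz] using hx)
  intro y hy
  obtain ⟨y', hy', e⟩ := h.translate_subset s hs _ (interior_subset hy)
  have : y' = y := A.injective (by simpa using e)
  exact this ▸ hy'

/-- Blowing up twice: `A (B G)` is tiled by the `G + s + A t`. -/
theorem IsTiling.comp (hA : IsTiling A G S) (hB : IsTiling B G T) :
    IsTiling (A * B : E ≃L[ℝ] E) G (image2 (fun s t => s + A t) S T) where
  finite := hA.finite.image2 _ hB.finite
  translate_subset := by
    rintro _ ⟨s, hs, t, ht, rfl⟩ x hx
    obtain ⟨y, hy, e⟩ := hA.translate_subset s hs x hx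
    obtain ⟨z, hz, e'⟩ := hB.translate_subset t ht y hy
    refine ⟨z, hz, ?_⟩
    change A (B z) = _
    rw [e', map_add, e, add_assoc]
  subset_translates := by
    intro z hz
    obtain ⟨t, ht, y, hy, e⟩ := hB.subset_translates z hz
    obtain ⟨s, hs, x, hx, e'⟩ := hA.subset_translates y hy
    refine ⟨_, mem_image2_of_mem hs ht, x, hx, ?_⟩
    change A (B z) = _
    rw [e, map_add, e', add_assoc]
  eq_of_interior := by
    rintro _ ⟨s, hs, t, ht, rfl⟩ _ ⟨s', hs', t', ht', rfl⟩ x hx y hy e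
    obtain ⟨u, -, hu⟩ := hA.translate_subset s hs x (interior_subset hx)
    obtain ⟨v, -, hv⟩ := hA.translate_subset s' hs' y (interior_subset hy)
    have e' : u + t = v + t' := by
      apply A.injective
      rw [map_add, map_add, hu, hv, add_assoc, add_assoc]
      exact e
    have ht : t = t' := hB.eq_of_interior t ht t' ht' u (hA.mem_interior hs hx hu) v
      (hA.mem_interior hs' hy hv) e'
    subst ht
    have : x + s = y + s' := by simpa [← add_assoc] using e
    rw [hA.eq_of_interior s hs s' hs' x hx y hy this]

theorem IsTiling.one (G : Set E) : IsTiling (1 : E ≃L[ℝ] E) G {0} where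
  finite := finite_singleton _
  translate_subset := by rintro _ rfl x hx; exact ⟨x, hx, (add_zero x).symm⟩
  subset_translates := fun z hz => ⟨0, rfl, z, hz, (add_zero z).symm⟩
  eq_of_interior := by rintro _ rfl _ rfl; simp

theorem IsTiling.pow (h : IsTiling A G S) (k : ℕ) :
    ∃ T, (0 ∈ S → 0 ∈ T) ∧ IsTiling (A ^ k : E ≃L[ℝ] E) G T := by
  induction k with
  | zero => exact ⟨{0}, fun _ => rfl, IsTiling.one G⟩
  | succ k ih =>
    obtain ⟨T, hT0, hT⟩ := ih
    rw [pow_succ]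
    exact ⟨_, fun h0 => mem_image2.2 ⟨0, hT0 h0, 0, h0, by simp⟩, hT.comp h⟩

end comp

/-! ### Tilings of the quadrant -/

theorem interior_preimage_swap (G : Set (ℝ × ℝ)) :
    interior (Prod.swap ⁻¹' G) = Prod.swap ⁻¹' interior G :=
  ((Homeomorph.prodComm ℝ ℝ).preimage_interior G).symm

theorem IsTiling.swap {a b : ℝ} {G S : Set (ℝ × ℝ)}
    (hS : IsTiling (fun p => (a * p.1, b * p.2)) G S) :
    IsTiling (fun p => (b * p.1, a * p.2)) (Prod.swap ⁻¹' G) (Prod.swap ⁻¹' S) := by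
  have sw : ∀ {a b : ℝ × ℝ}, a = b → a.swap = b.swap := fun e => by rw [e]
  refine ⟨hS.finite.preimage Prod.swap_injective.injOn, ?_, ?_, ?_⟩
  · intro s hs x hx
    obtain ⟨z, hz, e⟩ := hS.translate_subset _ hs _ hx
    exact ⟨z.swap, by simpa using hz, sw e⟩
  · intro z hz
    obtain ⟨s, hs, x, hx, e⟩ := hS.subset_translates _ hz
    exact ⟨s.swap, by simpa using hs, x.swap, by simpa using hx, sw e⟩
  · rw [interior_preimage_swap]
    intro s hs t ht x hx y hy e
    exact Prod.swap_injective (hS.eq_of_interior _ hs _ ht _ hx _ hy (sw e))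

/-- A compact set `G` in the plane that is the closure of its connected interior, agrees with the
first quadrant near the origin, is mapped by all powers of `diag(l, m)`, where `l, m > 1`, to a set
tiled by translates of `G`, among them `G` itself, and each point of which can be reached by a
segment from the interior. -/
structure IsCornerTile (l m : ℝ) (G : Set (ℝ × ℝ)) : Prop where
  one_lt_left : 1 < l
  one_lt_right : 1 < m
  isCompact : IsCompact G
  closure_interior : closure (interior G) = G
  isConnected_interior : IsConnected (interior G)
  accessible : ∀ z ∈ G, ∃ u, ∀ t ∈ Ioc (0 : ℝ) 1, z + t • u ∈ interior G
  corner : ∃ ε > 0, ∀ z : ℝ × ℝ, ‖z‖ < ε → (z ∈ G ↔ 0 ≤ z.1 ∧ 0 ≤ z.2)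
  tiling : ∀ k : ℕ, ∃ S, 0 ∈ S ∧ IsTiling (fun p => (l ^ k * p.1, m ^ k * p.2)) G S

namespace IsCornerTile

variable {l m : ℝ} {G : Set (ℝ × ℝ)}

theorem swap (h : IsCornerTile l m G) : IsCornerTile m l (Prod.swap ⁻¹' G) := by
  have hi := interior_preimage_swap G
  have hI : (Prod.swap ⁻¹' G) = (Homeomorph.prodComm ℝ ℝ).symm '' G :=
    ((Homeomorph.prodComm ℝ ℝ).image_symm ▸ rfl)
  refine ⟨h.one_lt_right, h.one_lt_left, ?_, ?_, ?_, ?_, ?_, ?_⟩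
  · rw [hI]; exact h.isCompact.image (Homeomorph.continuous _)
  · rw [hi]
    refine ((Homeomorph.prodComm ℝ ℝ).preimage_closure (interior G)).symm.trans ?_
    rw [h.closure_interior]; rfl
  · rw [hi]
    have := h.isConnected_interior.image (Homeomorph.prodComm ℝ ℝ).symm
      (Homeomorph.continuous _).continuousOn
    rwa [Homeomorph.image_symm] at this
  · intro z hz
    obtain ⟨u, hu⟩ := h.accessible z.swap hz
    refine ⟨u.swap, fun t ht => ?_⟩
    rw [hi]
    exact hu t ht
  · obtain ⟨ε, hε, H⟩ := h.corner
    refine ⟨ε, hε, fun z hz => ?_⟩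
    rw [mem_preimage, H _ (by simpa [Prod.norm_def, max_comm] using hz), and_comm]
    rfl
  · intro k
    obtain ⟨S, h0, hS⟩ := h.tiling k
    exact ⟨Prod.swap ⁻¹' S, h0, hS.swap⟩

theorem eventually_norm_lt (h : IsCornerTile l m G) (w : ℝ × ℝ) {ε : ℝ} (hε : 0 < ε) :
    ∀ᶠ k : ℕ in Filter.atTop, ‖(w.1 / l ^ k, w.2 / m ^ k)‖ < ε := by
  have h1 : Filter.Tendsto (fun k : ℕ => w.1 / l ^ k) Filter.atTop (nhds 0) :=
    tendsto_const_nhds.div_atTop (tendsto_pow_atTop_atTop_of_one_lt h.one_lt_left)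
  have h2 : Filter.Tendsto (fun k : ℕ => w.2 / m ^ k) Filter.atTop (nhds 0) :=
    tendsto_const_nhds.div_atTop (tendsto_pow_atTop_atTop_of_one_lt h.one_lt_right)
  have := (h1.prodMk_nhds h2).norm
  rw [Prod.mk_zero_zero, norm_zero] at this
  exact this.eventually_lt_const hε

theorem left_pos (h : IsCornerTile l m G) (k : ℕ) : 0 < l ^ k :=
  pow_pos (by linarith [h.one_lt_left]) k

theorem right_pos (h : IsCornerTile l m G) (k : ℕ) : 0 < m ^ k :=
  pow_pos (by linarith [h.one_lt_right]) k

theorem isClosed (h : IsCornerTile l m G) : IsClosed G := h.isCompact.isClosed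

theorem zero_mem (h : IsCornerTile l m G) : (0 : ℝ × ℝ) ∈ G := by
  obtain ⟨ε, hε, H⟩ := h.corner
  exact (H 0 (by simpa using hε)).2 ⟨le_rfl, le_rfl⟩

theorem div_mem (h : IsCornerTile l m G) {z : ℝ × ℝ} (hz : z ∈ G) (k : ℕ) :
    (z.1 / l ^ k, z.2 / m ^ k) ∈ G := by
  obtain ⟨S, h0, hS⟩ := h.tiling k
  obtain ⟨y, hy, e⟩ := hS.translate_subset 0 h0 z hz
  rw [add_zero] at e
  have := h.left_pos k
  have := h.right_pos k
  rw [← e]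
  simp [mul_div_cancel_left₀, *, ne_of_gt]

/-- As `G` is contained in its blow-ups, and these agree with the quadrant in larger and larger
neighbourhoods of the origin, `G` is contained in the quadrant. -/
theorem nonneg (h : IsCornerTile l m G) {z : ℝ × ℝ} (hz : z ∈ G) : 0 ≤ z.1 ∧ 0 ≤ z.2 := by
  obtain ⟨ε, hε, H⟩ := h.corner
  obtain ⟨k, hk⟩ := (h.eventually_norm_lt z hε).exists
  obtain ⟨h1, h2⟩ := (H _ hk).1 (h.div_mem hz k)
  constructor
  · simpa using (le_div_iff₀ (h.left_pos k)).1 h1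
  · simpa using (le_div_iff₀ (h.right_pos k)).1 h2

theorem pos_of_mem_interior (h : IsCornerTile l m G) {z : ℝ × ℝ} (hz : z ∈ interior G) :
    0 < z.1 ∧ 0 < z.2 := by
  obtain ⟨ε, hε, H⟩ := Metric.isOpen_iff.1 isOpen_interior z hz
  have : (z.1 - ε / 2, z.2 - ε / 2) ∈ Metric.ball z ε := by
    rw [Metric.mem_ball, Prod.dist_eq]
    simp [abs_of_pos, hε]
  have := h.nonneg (interior_subset (H this))
  constructor <;> linarith [this.1, this.2]

/-- Every bounded part of the quadrant is covered by the tiles of all sufficiently large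
blow-ups. -/
theorem eventually_covered (h : IsCornerTile l m G) (w : ℝ × ℝ) :
    ∀ᶠ k : ℕ in Filter.atTop, ∀ S, IsTiling (fun p => (l ^ k * p.1, m ^ k * p.2)) G S →
      ∀ p : ℝ × ℝ, 0 ≤ p.1 → 0 ≤ p.2 → p.1 ≤ w.1 → p.2 ≤ w.2 → ∃ s ∈ S, p - s ∈ G := by
  obtain ⟨ε, hε, H⟩ := h.corner
  filter_upwards [h.eventually_norm_lt w hε] with k hk S hS p h1 h2 h3 h4
  have hl := h.left_pos k
  have hm := h.right_pos k
  have hp : (p.1 / l ^ k, p.2 / m ^ k) ∈ G := by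
    refine (H _ (lt_of_le_of_lt ?_ hk)).2 ⟨by positivity, by positivity⟩
    rw [Prod.norm_def, Prod.norm_def]
    refine max_le_max ?_ ?_
    · simp only [Real.norm_eq_abs]
      exact abs_le_abs_of_nonneg (by positivity) (by gcongr)
    · simp only [Real.norm_eq_abs]
      exact abs_le_abs_of_nonneg (by positivity) (by gcongr)
  obtain ⟨s, hs, x, hx, e⟩ := hS.subset_translates _ hp
  refine ⟨s, hs, ?_⟩
  have e' : p = x + s := by
    rw [← e]
    ext <;> simp <;> field_simp
  simpa [e'] using hx

theorem translate_nonneg (h : IsCornerTile l m G) {k : ℕ} {S : Set (ℝ × ℝ)}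
    (hS : IsTiling (fun p => (l ^ k * p.1, m ^ k * p.2)) G S) {s : ℝ × ℝ} (hs : s ∈ S) :
    0 ≤ s.1 ∧ 0 ≤ s.2 := by
  obtain ⟨z, hz, e⟩ := hS.translate_subset s hs 0 h.zero_mem
  rw [zero_add] at e
  obtain ⟨h1, h2⟩ := h.nonneg hz
  rw [← e]
  exact ⟨mul_nonneg (h.left_pos k).le h1, mul_nonneg (h.right_pos k).le h2⟩

theorem exists_isGreatest (h : IsCornerTile l m G) :
    ∃ f, 0 < f ∧ IsGreatest {x : ℝ | (x, (0 : ℝ)) ∈ G} f := by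
  have hc : IsCompact {x : ℝ | (x, (0 : ℝ)) ∈ G} := by
    refine (h.isCompact.image continuous_fst).of_isClosed_subset
      (h.isClosed.preimage (by fun_prop)) ?_
    exact fun x hx => ⟨_, hx, rfl⟩
  obtain ⟨f, hf⟩ := hc.exists_isGreatest ⟨0, h.zero_mem⟩
  refine ⟨f, ?_, hf⟩
  obtain ⟨ε, hε, H⟩ := h.corner
  have : (ε / 2, (0 : ℝ)) ∈ G := by
    refine (H _ ?_).2 ⟨by positivity, le_rfl⟩
    simp [Prod.norm_def, abs_of_pos, hε]
  linarith [hf.2 this]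

/-- A path in `G` between the end points of its bottom side meets the same path shifted along the
bottom by less than the length of this side, because their end points alternate. -/
theorem exists_overlap (h : IsCornerTile l m G) {f c : ℝ}
    (hf : IsGreatest {x : ℝ | (x, (0 : ℝ)) ∈ G} f) (hc : 0 < c) (hcf : c < f) :
    ∃ x ∈ interior G, ∃ y ∈ interior G, x = y + (c, 0) := by
  have key : ∀ z ∈ G, ∃ u ∈ interior G, JoinedIn (interior G ∪ {z}) z u := by
    intro z hz
    obtain ⟨u, hu⟩ := h.accessible z hz
    refine ⟨z + u, by simpa using hu 1 (by simp), JoinedIn.of_segment_subset ?_⟩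
    rw [segment_eq_image']
    rintro _ ⟨t, ht, rfl⟩
    rcases ht.1.eq_or_lt with rfl | h0
    · simp
    · left; simpa using hu t ⟨h0, ht.2⟩
  obtain ⟨u, hu, hju⟩ := key _ h.zero_mem
  obtain ⟨v, hv, hjv⟩ := key _ hf.1
  have huv := (isOpen_interior.isConnected_iff_isPathConnected.1 h.isConnected_interior).joinedIn
    u hu v hv
  have hsub : ∀ {a b : Set (ℝ × ℝ)}, interior G ∪ a ⊆ interior G ∪ (a ∪ b) := by
    intro a b
    exact union_subset_union_right _ subset_union_left
  have hsub' : ∀ {a b : Set (ℝ × ℝ)}, interior G ∪ b ⊆ interior G ∪ (a ∪ b) := by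
    intro a b
    exact union_subset_union_right _ subset_union_right
  obtain ⟨γ, hγ⟩ := ((hju.mono hsub).trans (huv.mono subset_union_left)).trans
    (hjv.mono hsub').symm
  have hγ' : ∀ s : ℝ, γ.extend s ∈ interior G ∨
      (γ.extend s).2 = 0 ∧ ((γ.extend s).1 = 0 ∨ (γ.extend s).1 = f) := by
    intro s
    obtain ⟨t, ht⟩ : γ.extend s ∈ range γ := γ.extend_range ▸ mem_range_self s
    rw [← ht]
    rcases hγ t with h1 | h1 | h1
    · exact Or.inl h1
    · right; rw [mem_singleton_iff.1 h1]; simp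
    · right; rw [mem_singleton_iff.1 h1]; simp
  have hnn : ∀ s : ℝ, 0 ≤ (γ.extend s).2 := by
    intro s
    rcases hγ' s with h1 | h1
    · exact (h.pos_of_mem_interior h1).2.le
    · exact h1.1.ge
  obtain ⟨s, t, hst⟩ := exists_eq_of_alternating_endpoints
    (γ := fun s => Complex.equivRealProdCLM.symm (γ.extend s))
    (δ := fun s => Complex.equivRealProdCLM.symm (γ.extend s + (c, 0)))
    (a := 0) (b := f) (c := c) (d := f + c)
    (by fun_prop) (by fun_prop)
    (fun s => by simpa using hnn s) (fun s => by simpa using hnn s)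
    hc hcf (by linarith)
    (by simp) (by simp [Complex.ext_iff])
    (by simp [Complex.ext_iff]) (by simp [Complex.ext_iff])
  have hst := Complex.equivRealProdCLM.symm.injective hst
  have e2 := congrArg Prod.snd hst
  have e1 := congrArg Prod.fst hst
  simp only [Prod.fst_add, Prod.snd_add, add_zero] at e1 e2
  -- The paths cannot meet at an end point, so they meet in the interior.
  rcases hγ' s with h1 | ⟨h1, h1'⟩ <;> rcases hγ' t with h2 | ⟨h2, h2'⟩
  · exact ⟨_, h1, _, h2, hst⟩
  · linarith [(h.pos_of_mem_interior h1).2]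
  · linarith [(h.pos_of_mem_interior h2).2]
  · rcases h1' with h1' | h1' <;> rcases h2' with h2' | h2' <;> linarith

/-- No two tiles are shifted along the bottom side by less than its length. -/
theorem eq_zero_of_translate_bottom (h : IsCornerTile l m G) {f c : ℝ}
    (hf : IsGreatest {x : ℝ | (x, (0 : ℝ)) ∈ G} f) {k : ℕ} {S : Set (ℝ × ℝ)}
    (h0 : 0 ∈ S) (hS : IsTiling (fun p => (l ^ k * p.1, m ^ k * p.2)) G S)
    (hs : (c, 0) ∈ S) (hcf : c < f) : c = 0 := by
  by_contra hc
  have hc : 0 < c := lt_of_le_of_ne (h.translate_nonneg hS hs).1 (Ne.symm hc)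
  obtain ⟨x, hx, y, hy, e⟩ := h.exists_overlap hf hc hcf
  have := hS.eq_of_interior 0 h0 _ hs x hx y hy (by rw [add_zero, e])
  simp only [Prod.ext_iff, Prod.fst_zero] at this
  exact hc.ne this.1

/-- A tile that contains a point of the horizontal axis has its corner on this axis. -/
theorem snd_eq_zero_of_mem (h : IsCornerTile l m G) {k : ℕ} {S : Set (ℝ × ℝ)}
    (hS : IsTiling (fun p => (l ^ k * p.1, m ^ k * p.2)) G S) {s p : ℝ × ℝ}
    (hs : s ∈ S) (hp : p - s ∈ G) (hp0 : p.2 = 0) : s.2 = 0 := by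
  have h1 := (h.nonneg hp).2
  have h2 := (h.translate_nonneg hS hs).2
  simp only [Prod.snd_sub] at h1
  linarith

theorem isClosed_other_tiles (h : IsCornerTile l m G) {A : ℝ × ℝ → ℝ × ℝ} {S : Set (ℝ × ℝ)}
    (hS : IsTiling A G S) : IsClosed {p : ℝ × ℝ | ∃ s ∈ S, s ≠ 0 ∧ p - s ∈ G} := by
  have : {p : ℝ × ℝ | ∃ s ∈ S, s ≠ 0 ∧ p - s ∈ G}
      = ⋃ s ∈ S ∩ {s | s ≠ 0}, (fun p => p - s) ⁻¹' G := by
    ext p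
    simp [and_assoc]
  rw [this]
  exact (hS.finite.inter_of_left _).isClosed_biUnion
    fun s _ => h.isClosed.preimage (by fun_prop)

/-- Near an inner point of its bottom side `G` agrees with the upper half-plane, as no other tile
of the quadrant contains this point. -/
theorem eventually_mem_interior_of_bottom (h : IsCornerTile l m G) {f r : ℝ}
    (hf : IsGreatest {x : ℝ | (x, (0 : ℝ)) ∈ G} f) (hr0 : 0 < r) (hrf : r < f) :
    ∀ᶠ p in nhds (r, (0 : ℝ)), 0 < p.2 → p ∈ interior G := by
  suffices ∀ᶠ p in nhds (r, (0 : ℝ)), 0 ≤ p.2 → p ∈ G by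
    filter_upwards [this.eventually_nhds] with p hp hp2
    rw [mem_interior_iff_mem_nhds]
    filter_upwards [hp, continuous_snd.continuousAt.eventually (lt_mem_nhds hp2)] with q h1 h2
      using h1 h2.le
  obtain ⟨k, hk⟩ := (h.eventually_covered (r + 1, 1)).exists
  obtain ⟨S, h0, hS⟩ := h.tiling k
  have hnot : (r, (0 : ℝ)) ∉ {p : ℝ × ℝ | ∃ s ∈ S, s ≠ 0 ∧ p - s ∈ G} := by
    rintro ⟨⟨c, d⟩, hs, hne, hp⟩
    obtain rfl : d = 0 := h.snd_eq_zero_of_mem hS hs hp rfl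
    have h1 := (h.nonneg hp).1
    simp only [Prod.fst_sub] at h1
    refine hne ?_
    rw [h.eq_zero_of_translate_bottom hf h0 hS hs (by linarith)]
    rfl
  have e1 := (h.isClosed_other_tiles hS).isOpen_compl.mem_nhds hnot
  have e2 : ∀ᶠ p : ℝ × ℝ in nhds (r, (0 : ℝ)), 0 < p.1 :=
    continuous_fst.continuousAt.eventually (lt_mem_nhds hr0)
  have e3 : ∀ᶠ p : ℝ × ℝ in nhds (r, (0 : ℝ)), p.1 < r + 1 :=
    continuous_fst.continuousAt.eventually (gt_mem_nhds (by simp))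
  have e4 : ∀ᶠ p : ℝ × ℝ in nhds (r, (0 : ℝ)), p.2 < 1 :=
    continuous_snd.continuousAt.eventually (gt_mem_nhds (by simp))
  filter_upwards [e1, e2, e3, e4] with p h1 h2 h3 h4 h5
  obtain ⟨s, hs, hp⟩ := hk S hS p h2.le h5 h3.le h4.le
  by_cases hs0 : s = 0
  · simpa [hs0] using hp
  · exact absurd ⟨s, hs, hs0, hp⟩ h1

/-- The tile next to `G` along the bottom. -/
theorem eventually_bottom_neighbour_mem (h : IsCornerTile l m G) {f : ℝ} (hf0 : 0 < f)
    (hf : IsGreatest {x : ℝ | (x, (0 : ℝ)) ∈ G} f) :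
    ∀ᶠ k : ℕ in Filter.atTop, ∀ S, 0 ∈ S →
      IsTiling (fun p => (l ^ k * p.1, m ^ k * p.2)) G S → (f, 0) ∈ S := by
  filter_upwards [h.eventually_covered (f + 1, 0)] with k hk S h0 hS
  have hcl := h.isClosed_other_tiles hS
  have hmem : (f, (0 : ℝ)) ∈ {p : ℝ × ℝ | ∃ s ∈ S, s ≠ 0 ∧ p - s ∈ G} := by
    have ht : Filter.Tendsto (fun x : ℝ => (x, (0 : ℝ))) (nhdsWithin f (Ioi f))
        (nhds (f, (0 : ℝ))) :=
      (Continuous.tendsto (f := fun x : ℝ => (x, (0 : ℝ))) (by fun_prop) f).mono_left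
        nhdsWithin_le_nhds
    refine hcl.mem_of_tendsto ht ?_
    filter_upwards [Ioo_mem_nhdsGT (lt_add_one f)] with x hx
    obtain ⟨s, hs, hp⟩ := hk S hS (x, 0) (hf0.trans hx.1).le le_rfl hx.2.le le_rfl
    refine ⟨s, hs, ?_, hp⟩
    rintro rfl
    rw [sub_zero] at hp
    exact absurd (hf.2 hp) (not_le.2 hx.1)
  obtain ⟨⟨c, d⟩, hs, hne, hp⟩ := hmem
  obtain rfl : d = 0 := h.snd_eq_zero_of_mem hS hs hp rfl
  have h1 := (h.nonneg hp).1
  simp only [Prod.fst_sub] at h1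
  have h2 : ¬ c < f := fun hc => hne (by
    rw [h.eq_zero_of_translate_bottom hf h0 hS hs hc]; rfl)
  obtain rfl : c = f := by linarith
  exact hs

/-- The bottom right corner of a blow-up of `G` is the bottom right corner of a tile, so that the
blow-ups of `G` at this corner contain `G`. -/
theorem right_corner_div_mem (h : IsCornerTile l m G) {f : ℝ}
    (hf : IsGreatest {x : ℝ | (x, (0 : ℝ)) ∈ G} f) {z : ℝ × ℝ} (hz : z ∈ G) (k : ℕ) :
    (f + (z.1 - f) / l ^ k, z.2 / m ^ k) ∈ G := by
  obtain ⟨S, h0, hS⟩ := h.tiling k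
  have hl := h.left_pos k
  have hm := h.right_pos k
  obtain ⟨⟨c, d⟩, hs, ⟨x, x'⟩, hx, e⟩ := hS.subset_translates _ hf.1
  simp only [mul_zero, Prod.mk_add_mk, Prod.mk.injEq] at e
  have hd := (h.translate_nonneg hS hs).2
  have hx' := (h.nonneg hx).2
  obtain rfl : d = 0 := by simp only at hd hx'; linarith
  obtain rfl : x' = 0 := by linarith
  have hxf : x ≤ f := hf.2 hx
  obtain ⟨⟨y, y'⟩, hy, e'⟩ := hS.translate_subset _ hs _ hf.1
  simp only [Prod.mk_add_mk, add_zero, Prod.mk.injEq] at e'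
  obtain rfl : y' = 0 := by simpa [hm.ne'] using e'.2
  have hyf : l ^ k * y ≤ l ^ k * f := mul_le_mul_of_nonneg_left (hf.2 hy) hl.le
  have hc : c = l ^ k * f - f := by linarith
  obtain ⟨w, hw, ew⟩ := hS.translate_subset _ hs z hz
  have : (f + (z.1 - f) / l ^ k, z.2 / m ^ k) = w := by
    have e1 := congrArg Prod.fst ew
    have e2 := congrArg Prod.snd ew
    simp only [Prod.fst_add, Prod.snd_add, add_zero] at e1 e2
    ext
    · simp only
      field_simp
      linarith
    · simp only
      field_simp
      linarith
  exact this ▸ hw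

/-- Near the right end of its bottom side, `G` stays to the left of the neighbouring tile, and
blowing up at this point shows that this holds for all points of `G`. -/
theorem fst_le (h : IsCornerTile l m G) {f : ℝ} (hf0 : 0 < f)
    (hf : IsGreatest {x : ℝ | (x, (0 : ℝ)) ∈ G} f) {z : ℝ × ℝ} (hz : z ∈ G) : z.1 ≤ f := by
  by_contra! hlt
  obtain ⟨ε, hε, H⟩ := h.corner
  obtain ⟨k, hk1⟩ := (h.eventually_bottom_neighbour_mem hf0 hf).exists
  obtain ⟨S, h0, hS⟩ := h.tiling k
  have hfS := hk1 S h0 hS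
  -- Contracting towards `(f, 0)` moves `z` into the part of `G + (f, 0)` that is known to be a
  -- quadrant.
  obtain ⟨j, hj⟩ := (h.eventually_norm_lt (z.1 - f, z.2) hε).exists
  have hzj := h.right_corner_div_mem hf hz j
  set w := (f + (z.1 - f) / l ^ j, z.2 / m ^ j) with hw
  rw [← h.closure_interior] at hzj
  have ho : IsOpen {p : ℝ × ℝ | f < p.1 ∧ ‖p - (f, 0)‖ < ε} :=
    (isOpen_lt continuous_const continuous_fst).inter
      (isOpen_lt (continuous_id.sub continuous_const).norm continuous_const)
  obtain ⟨u, ⟨hu1, hu2⟩, hu⟩ := mem_closure_iff.1 hzj _ ho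
    ⟨by simpa [hw] using div_pos (sub_pos.2 hlt) (h.left_pos j), by simpa [hw] using hj⟩
  have ho' : IsOpen {p : ℝ × ℝ | ‖p‖ < ε ∧ 0 < p.1 ∧ 0 < p.2} :=
    (isOpen_lt continuous_norm continuous_const).inter
      ((isOpen_lt continuous_const continuous_fst).inter
        (isOpen_lt continuous_const continuous_snd))
  have hsub : {p : ℝ × ℝ | ‖p‖ < ε ∧ 0 < p.1 ∧ 0 < p.2} ⊆ interior G :=
    interior_maximal (fun p hp => (H p hp.1).2 ⟨hp.2.1.le, hp.2.2.le⟩) ho'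
  have hv : u - (f, 0) ∈ interior G := hsub
    ⟨hu2, by simpa using hu1, by simpa using (h.pos_of_mem_interior hu).2⟩
  have := hS.eq_of_interior 0 h0 _ hfS u hu _ hv (by simp)
  simp only [Prod.ext_iff, Prod.fst_zero] at this
  exact hf0.ne this.1

/-- A corner tile is a rectangle. -/
theorem exists_eq_prod (h : IsCornerTile l m G) :
    ∃ f g : ℝ, 0 < f ∧ 0 < g ∧ G = Icc 0 f ×ˢ Icc 0 g := by
  obtain ⟨f, hf0, hf⟩ := h.exists_isGreatest
  obtain ⟨g, hg0, hg⟩ := h.swap.exists_isGreatest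
  refine ⟨f, g, hf0, hg0, Subset.antisymm ?_ ?_⟩
  · intro z hz
    obtain ⟨h1, h2⟩ := h.nonneg hz
    exact ⟨⟨h1, h.fst_le hf0 hf hz⟩, h2, h.swap.fst_le hg0 hg (z := z.swap) (by simpa using hz)⟩
  have hopen : Ioo 0 f ×ˢ Ioo 0 g ⊆ G := by
    rintro ⟨a, b⟩ ⟨⟨ha0, haf⟩, hb0, hbg⟩
    simp only at ha0 haf hb0 hbg
    obtain ⟨k, hk1, hk2⟩ := ((h.eventually_covered (a, b)).and
      (h.eventually_bottom_neighbour_mem hf0 hf)).exists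
    obtain ⟨S, h0, hS⟩ := h.tiling k
    have hfS := hk2 S h0 hS
    obtain ⟨⟨x, y⟩, hs, hp⟩ := hk1 S hS (a, b) ha0.le hb0.le le_rfl le_rfl
    obtain ⟨hx0, hy0⟩ := h.translate_nonneg hS hs
    obtain ⟨hxa, hyb⟩ := h.nonneg hp
    simp only [Prod.mk_sub_mk, sub_nonneg] at hx0 hy0 hxa hyb
    by_cases hs0 : ((x, y) : ℝ × ℝ) = 0
    · simpa [hs0] using hp
    exfalso
    have hx : 0 < x := by
      refine lt_of_le_of_ne hx0 ?_
      rintro rfl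
      refine hs0 ?_
      rw [h.swap.eq_zero_of_translate_bottom hg (S := Prod.swap ⁻¹' S) h0 hS.swap (c := y) hs
        (by linarith)]
      rfl
    have hy : 0 < y := by
      refine lt_of_le_of_ne hy0 ?_
      rintro rfl
      refine hs0 ?_
      rw [h.eq_zero_of_translate_bottom hf h0 hS hs (by linarith)]
      rfl
    -- The bottom side of `G + (x, y)` crosses the left side of `G + (f, 0)` at `(f, y)`.
    have n1 := h.eventually_mem_interior_of_bottom hf (r := f - x) (by linarith) (by linarith)
    have n2 := h.swap.eventually_mem_interior_of_bottom hg (r := y) hy (by linarith)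
    have t1 : Filter.Tendsto (fun δ : ℝ => (f - x + δ, δ)) (nhdsWithin 0 (Ioi 0))
        (nhds (f - x, 0)) := by
      have : Continuous (fun δ : ℝ => (f - x + δ, δ)) := by fun_prop
      simpa using (this.tendsto 0).mono_left nhdsWithin_le_nhds
    have t2 : Filter.Tendsto (fun δ : ℝ => (y + δ, δ)) (nhdsWithin 0 (Ioi 0))
        (nhds (y, 0)) := by
      have : Continuous (fun δ : ℝ => (y + δ, δ)) := by fun_prop
      simpa using (this.tendsto 0).mono_left nhdsWithin_le_nhds
    obtain ⟨δ, ⟨m1, m2⟩, hδ⟩ := (((t1.eventually n1).and (t2.eventually n2)).and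
      (self_mem_nhdsWithin (s := Ioi (0 : ℝ)))).exists
    have m1 := m1 hδ
    have m2 := m2 hδ
    rw [interior_preimage_swap] at m2
    have := hS.eq_of_interior _ hs _ hfS _ m1 _ m2 (by ext <;> simp <;> ring)
    simp only [Prod.mk.injEq] at this
    exact hy.ne' this.2
  have := closure_mono hopen
  rwa [closure_prod_eq, closure_Ioo hf0.ne, closure_Ioo hg0.ne, h.isClosed.closure_eq] at this

end IsCornerTile

/-! ### Sets with polygonal boundary -/

/-- The determinant of two plane vectors. -/
def planeDet (v x : Fin 2 → ℝ) : ℝ := v 0 * x 1 - v 1 * x 0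

theorem planeDet_add (v x y : Fin 2 → ℝ) : planeDet v (x + y) = planeDet v x + planeDet v y := by
  simp only [planeDet, Pi.add_apply]; ring

theorem planeDet_sub (v x y : Fin 2 → ℝ) : planeDet v (x - y) = planeDet v x - planeDet v y := by
  simp only [planeDet, Pi.sub_apply]; ring

theorem planeDet_smul (v x : Fin 2 → ℝ) (t : ℝ) : planeDet v (t • x) = t * planeDet v x := by
  simp only [planeDet, Pi.smul_apply, smul_eq_mul]; ring

theorem planeDet_self (v : Fin 2 → ℝ) : planeDet v v = 0 := by
  simp only [planeDet]; ring

theorem planeDet_comm (v w : Fin 2 → ℝ) : planeDet v w = -planeDet w v := by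
  simp only [planeDet]; ring

@[fun_prop]
theorem continuous_planeDet (v : Fin 2 → ℝ) : Continuous (planeDet v) := by
  unfold planeDet; fun_prop

/-- The coordinates of a vector in a basis of the plane, by Cramer's rule. -/
theorem planeDet_smul_eq (v w x : Fin 2 → ℝ) :
    planeDet v w • x = planeDet x w • v + planeDet v x • w := by
  ext i
  fin_cases i <;> simp [planeDet] <;> ring

theorem eq_smul_of_planeDet_eq_zero {v x : Fin 2 → ℝ} (hv : v ≠ 0) (h : planeDet v x = 0) :
    ∃ c : ℝ, x = c • v := by
  have hs : v 0 * v 0 + v 1 * v 1 ≠ 0 := by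
    intro h0
    refine hv ?_
    have h1 : v 0 = 0 := by nlinarith [mul_self_nonneg (v 0), mul_self_nonneg (v 1)]
    have h2 : v 1 = 0 := by nlinarith [mul_self_nonneg (v 0), mul_self_nonneg (v 1)]
    ext i
    fin_cases i <;> simp [h1, h2]
  refine ⟨(v 0 * x 0 + v 1 * x 1) / (v 0 * v 0 + v 1 * v 1), ?_⟩
  unfold planeDet at h
  ext i
  rw [Pi.smul_apply, smul_eq_mul, div_mul_eq_mul_div, eq_div_iff hs]
  fin_cases i
  · simp only [Fin.zero_eta]
    linear_combination (-v 1) * h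
  · simp only [Fin.mk_one]
    linear_combination (v 0) * h

theorem exists_planeDet_ne_zero {v : Fin 2 → ℝ} (hv : v ≠ 0) : ∃ w, planeDet v w ≠ 0 := by
  by_contra! h
  refine hv ?_
  have h0 := h ![1, 0]
  have h1 := h ![0, 1]
  simp [planeDet] at h0 h1
  ext i
  fin_cases i <;> simp [h0, h1]

/-- A compact plane set `G`, the closure of its connected interior, whose boundary is the union of
the segments from `P i` to `P i + V i`, where `V i ≠ 0`. -/
structure IsPolygonal {ι : Type*} (P V : ι → Fin 2 → ℝ) (G : Set (Fin 2 → ℝ)) : Prop where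
  isCompact : IsCompact G
  closure_interior : closure (interior G) = G
  isConnected_interior : IsConnected (interior G)
  ne_zero : ∀ i, V i ≠ 0
  frontier_eq : frontier G = ⋃ i, segment ℝ (P i) (P i + V i)

/-- A linear map that fixes the lines spanned by the vectors `V i` and does not interchange the two
sides of any of them. -/
def PreservesSides {ι : Type*} (V : ι → Fin 2 → ℝ) (B : (Fin 2 → ℝ) → Fin 2 → ℝ) : Prop :=
  ∀ i, ∃ κ > 0, ∀ d, planeDet (V i) (B d) = κ * planeDet (V i) d

/-- The tangent cone of `G` at `z`: the directions of the segments in `G` that start at `z`. -/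
def germCone (G : Set (Fin 2 → ℝ)) (z : Fin 2 → ℝ) : Set (Fin 2 → ℝ) :=
  {d | ∀ᶠ t : ℝ in nhdsWithin 0 (Ioi 0), z + t • d ∈ G}

namespace IsPolygonal

variable {ι : Type*} {P V : ι → Fin 2 → ℝ} {G : Set (Fin 2 → ℝ)}

theorem isClosed (h : IsPolygonal P V G) : IsClosed G := h.isCompact.isClosed

variable [Finite ι]

theorem dense_planeDet_ne_zero (hV : ∀ i, V i ≠ 0) : Dense {d | ∀ i, planeDet (V i) d ≠ 0} := by
  simp only [ofPred_forall]
  refine dense_iInter_of_isOpen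
    (fun i => isOpen_ne_fun (continuous_planeDet _) continuous_const) fun i d => ?_
  obtain ⟨w, hw⟩ := exists_planeDet_ne_zero (hV i)
  by_cases hd : planeDet (V i) d = 0
  · have ht : Filter.Tendsto (fun t : ℝ => d + t • w) (nhdsWithin 0 (Ioi 0)) (nhds d) := by
      have : Continuous (fun t : ℝ => d + t • w) := by fun_prop
      simpa using (this.tendsto 0).mono_left nhdsWithin_le_nhds
    refine mem_closure_of_tendsto ht ?_
    filter_upwards [self_mem_nhdsWithin] with t ht
    simpa [planeDet_add, planeDet_smul, hd] using ⟨ne_of_gt ht, hw⟩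
  · exact subset_closure hd

/-- Near a point `z`, the lines through the edges that contain `z` cut the plane into sectors, and
each open sector is either in the interior of `G` or disjoint from `G`. -/
theorem exists_radius (h : IsPolygonal P V G) (z : Fin 2 → ℝ) :
    ∃ ε > 0, ∀ d d' : Fin 2 → ℝ, ‖d‖ < ε → ‖d'‖ < ε →
      (∀ i, planeDet (V i) (z - P i) = 0 → 0 < planeDet (V i) d * planeDet (V i) d') →
      z + d ∈ G → z + d' ∈ interior G := by
  have hev : ∀ᶠ d in nhds (0 : Fin 2 → ℝ), ∀ i, planeDet (V i) (z - P i) ≠ 0 →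
      planeDet (V i) (z + d - P i) ≠ 0 := by
    rw [Filter.eventually_all]
    intro i
    by_cases hi : planeDet (V i) (z - P i) = 0
    · simp [hi]
    · have : Continuous fun d => planeDet (V i) (z + d - P i) := by fun_prop
      filter_upwards [this.continuousAt.eventually_ne (x := 0) (y := 0) (by simpa using hi)]
        with d hd _ using hd
  obtain ⟨ε, hε, H⟩ := Metric.eventually_nhds_iff.1 hev
  refine ⟨ε, hε, fun d d' hd hd' hs hz => ?_⟩
  have hfr : ∀ w ∈ segment ℝ (z + d) (z + d'), w ∉ frontier G := by
    rintro w hw hwf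
    rw [segment_eq_image] at hw
    obtain ⟨t, ⟨ht0, ht1⟩, rfl⟩ := hw
    have hn : ‖(1 - t) • d + t • d'‖ < ε := by
      have := (convex_ball (0 : Fin 2 → ℝ) ε) (mem_ball_zero_iff.2 hd) (mem_ball_zero_iff.2 hd')
        (sub_nonneg.2 ht1) ht0 (by ring)
      simpa using this
    have e : (1 - t) • (z + d) + t • (z + d') = z + ((1 - t) • d + t • d') := by
      module
    simp only at hwf
    rw [e, h.frontier_eq] at hwf
    obtain ⟨i, hi⟩ := mem_iUnion.1 hwf
    rw [segment_eq_image'] at hi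
    obtain ⟨s, -, hs'⟩ := hi
    have h0 : planeDet (V i) (z + ((1 - t) • d + t • d') - P i) = 0 := by
      rw [← hs']
      simp [planeDet_smul, planeDet_self]
    by_cases hi : planeDet (V i) (z - P i) = 0
    · have h1 := hs i hi
      have h2 : (1 - t) * planeDet (V i) d + t * planeDet (V i) d' = 0 := by
        rw [add_sub_right_comm, planeDet_add, hi, planeDet_add, planeDet_smul, planeDet_smul] at h0
        linarith
      rcases pos_and_pos_or_neg_and_neg_of_mul_pos h1 with ⟨h3, h4⟩ | ⟨h3, h4⟩
      · rcases ht0.eq_or_lt with rfl | ht0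
        · simp at h2; linarith
        · nlinarith [mul_pos ht0 h4]
      · rcases ht0.eq_or_lt with rfl | ht0
        · simp at h2; linarith
        · nlinarith [mul_pos ht0 (neg_pos.2 h4)]
    · exact H (by simpa using hn) i hi h0
  have hin : ∀ w ∈ segment ℝ (z + d) (z + d'), w ∈ G → w ∈ interior G := fun w hw hwG => by
    rw [← self_sdiff_frontier]
    exact ⟨hwG, hfr w hw⟩
  refine (convex_segment (z + d) (z + d')).isPreconnected.subset_left_of_subset_union
    isOpen_interior h.isClosed.isOpen_compl
    (disjoint_compl_right.mono_left interior_subset) (fun w hw => ?_)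
    ⟨_, left_mem_segment ℝ _ _, hin _ (left_mem_segment ℝ _ _) hz⟩ (right_mem_segment ℝ _ _)
  by_cases hwG : w ∈ G
  · exact Or.inl (hin w hw hwG)
  · exact Or.inr hwG

/-- Near `z`, the set `G` is invariant under the maps that preserve the sides of the lines through
the edges; in particular it is conical at `z`. -/
theorem exists_radius_preservesSides (h : IsPolygonal P V G) (z : Fin 2 → ℝ) :
    ∃ ε > 0, ∀ B : (Fin 2 → ℝ) → Fin 2 → ℝ, Continuous B → PreservesSides V B →
      ∀ d, ‖d‖ < ε → ‖B d‖ < ε → z + d ∈ G → z + B d ∈ G := by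
  obtain ⟨ε, hε, H⟩ := h.exists_radius z
  refine ⟨ε, hε, fun B hBc hB d hd hBd hz => ?_⟩
  have hz' : d ∈ closure ((fun d => z + d) ⁻¹' interior G) := by
    have := ((Homeomorph.addLeft z).preimage_closure (interior G)).symm
    change closure ((Homeomorph.addLeft z) ⁻¹' interior G) = _ at this
    change d ∈ closure ((Homeomorph.addLeft z) ⁻¹' interior G)
    rw [this, h.closure_interior]
    exact hz
  have hW : IsOpen {d : Fin 2 → ℝ | ‖d‖ < ε ∧ ‖B d‖ < ε} :=
    (isOpen_lt continuous_norm continuous_const).inter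
      (isOpen_lt hBc.norm continuous_const)
  have ho : IsOpen ((fun d => z + d) ⁻¹' interior G) := isOpen_interior.preimage (by fun_prop)
  have hd' : d ∈ closure ({d : Fin 2 → ℝ | ‖d‖ < ε ∧ ‖B d‖ < ε} ∩
      (((fun d => z + d) ⁻¹' interior G) ∩ {d | ∀ i, planeDet (V i) d ≠ 0})) := by
    have h1 := closure_mono ((dense_planeDet_ne_zero h.ne_zero).open_subset_closure_inter ho)
    rw [closure_closure] at h1
    exact hW.inter_closure ⟨⟨hd, hBd⟩, h1 hz'⟩
  have := map_mem_closure (f := fun d => z + B d) (t := G) (by fun_prop) hd' ?_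
  · rwa [h.isClosed.closure_eq] at this
  · rintro e ⟨⟨he1, he2⟩, he3, he4⟩
    refine interior_subset (H e (B e) he1 he2 (fun i _ => ?_) (interior_subset he3))
    obtain ⟨κ, hκ, hi⟩ := hB i
    rw [hi]
    have := mul_self_pos.2 (he4 i)
    nlinarith [mul_pos hκ this]

end IsPolygonal

/-! ### Tangent cones -/

theorem exists_smul_norm_lt {E : Type*} [NormedAddCommGroup E] [NormedSpace ℝ E] (d : E) {ε : ℝ}
    (hε : 0 < ε) : ∃ t : ℝ, 0 < t ∧ t < 1 ∧ ‖t • d‖ < ε := by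
  have h1 : Filter.Tendsto (fun t : ℝ => ‖t • d‖) (nhdsWithin 0 (Ioi 0)) (nhds 0) := by
    have : Continuous (fun t : ℝ => ‖t • d‖) := by fun_prop
    simpa using (this.tendsto 0).mono_left nhdsWithin_le_nhds
  obtain ⟨t, ht, ht'⟩ := ((h1.eventually_lt_const hε).and
    (Ioo_mem_nhdsGT (zero_lt_one' ℝ))).exists
  exact ⟨t, ht'.1, ht'.2, ht⟩

theorem preservesSides_smul {ι : Type*} (V : ι → Fin 2 → ℝ) {t : ℝ} (ht : 0 < t) :
    PreservesSides V (t • ·) := fun _ => ⟨t, ht, fun _ => planeDet_smul _ _ _⟩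

theorem mem_germCone {G : Set (Fin 2 → ℝ)} {z d : Fin 2 → ℝ} :
    d ∈ germCone G z ↔ ∀ᶠ t : ℝ in nhdsWithin 0 (Ioi 0), z + t • d ∈ G := Iff.rfl

theorem smul_mem_germCone {G : Set (Fin 2 → ℝ)} {z d : Fin 2 → ℝ} (hd : d ∈ germCone G z) {t : ℝ}
    (ht : 0 < t) : t • d ∈ germCone G z := by
  have : Filter.Tendsto (fun s : ℝ => s * t) (nhdsWithin 0 (Ioi 0)) (nhdsWithin 0 (Ioi 0)) := by
    refine tendsto_nhdsWithin_iff.2 ⟨?_, ?_⟩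
    · have : Continuous (fun s : ℝ => s * t) := by fun_prop
      simpa using (this.tendsto 0).mono_left nhdsWithin_le_nhds
    · filter_upwards [self_mem_nhdsWithin] with s hs using mul_pos hs ht
  have := this.eventually hd
  simpa [mem_germCone, mul_smul] using this

theorem smul_mem_germCone_iff {G : Set (Fin 2 → ℝ)} {z d : Fin 2 → ℝ} {t : ℝ} (ht : 0 < t) :
    t • d ∈ germCone G z ↔ d ∈ germCone G z := by
  refine ⟨fun h => ?_, fun h => smul_mem_germCone h ht⟩
  simpa [smul_smul, ht.ne'] using smul_mem_germCone h (inv_pos.2 ht)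

namespace IsPolygonal

variable {ι : Type*} [Finite ι] {P V : ι → Fin 2 → ℝ} {G : Set (Fin 2 → ℝ)}

theorem exists_mem_germCone_iff (h : IsPolygonal P V G) (z : Fin 2 → ℝ) :
    ∃ ε > 0, ∀ d, ‖d‖ < ε → (d ∈ germCone G z ↔ z + d ∈ G) := by
  obtain ⟨ε, hε, H⟩ := h.exists_radius_preservesSides z
  refine ⟨ε, hε, fun d hd => ⟨fun hdC => ?_, fun hdG => ?_⟩⟩
  · obtain ⟨t, ht, ht0⟩ := ((mem_germCone.1 hdC).and (Ioo_mem_nhdsGT (zero_lt_one' ℝ))).exists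
    have hn : ‖t • d‖ < ε := by
      rw [norm_smul, Real.norm_of_nonneg ht0.1.le]
      nlinarith [norm_nonneg d, ht0.1, ht0.2]
    have := H (t⁻¹ • ·) (by fun_prop) (preservesSides_smul V (inv_pos.2 ht0.1)) (t • d) hn
    simp only [smul_smul, inv_mul_cancel₀ ht0.1.ne', one_smul] at this
    exact this hd ht
  · filter_upwards [Ioo_mem_nhdsGT (zero_lt_one' ℝ)] with t ht0
    have hn : ‖t • d‖ < ε := by
      rw [norm_smul, Real.norm_of_nonneg ht0.1.le]
      nlinarith [norm_nonneg d, ht0.1, ht0.2]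
    exact H (t • ·) (by fun_prop) (preservesSides_smul V ht0.1) d hd hn hdG

theorem isClosed_germCone (h : IsPolygonal P V G) (z : Fin 2 → ℝ) : IsClosed (germCone G z) := by
  obtain ⟨ε, hε, H⟩ := h.exists_mem_germCone_iff z
  refine isClosed_of_closure_subset fun d hd => ?_
  obtain ⟨t, ht, -, htd⟩ := exists_smul_norm_lt d hε
  rw [← smul_mem_germCone_iff ht, H _ htd]
  have h1 : t • d ∈ closure (germCone G z) :=
    map_mem_closure (continuous_const_smul t) hd fun x hx => smul_mem_germCone hx ht
  have h2 := (isOpen_lt (continuous_norm (E := Fin 2 → ℝ)) continuous_const).inter_closure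
    ⟨htd, h1⟩
  have := map_mem_closure (f := fun d => z + d) (t := G) (by fun_prop) h2
    (fun x hx => (H x hx.1).1 hx.2)
  rwa [h.isClosed.closure_eq] at this

theorem map_mem_germCone (h : IsPolygonal P V G) {z d : Fin 2 → ℝ}
    (B : (Fin 2 → ℝ) →L[ℝ] (Fin 2 → ℝ)) (hB : PreservesSides V B) (hd : d ∈ germCone G z) :
    B d ∈ germCone G z := by
  obtain ⟨ε, hε, H⟩ := h.exists_mem_germCone_iff z
  obtain ⟨ε', hε', H'⟩ := h.exists_radius_preservesSides z
  obtain ⟨t, ht, -, htd⟩ := exists_smul_norm_lt (d, B d) (lt_min hε hε')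
  rw [Prod.smul_mk, Prod.norm_mk, max_lt_iff, lt_min_iff, lt_min_iff, ← map_smul] at htd
  rw [← smul_mem_germCone_iff ht, ← map_smul, H _ htd.2.1]
  rw [← smul_mem_germCone_iff ht, H _ htd.1.1] at hd
  exact H' B B.continuous hB _ htd.1.2 htd.2.2 hd

/-- Two directions on the same side of each edge line through `z` belong both or none to the
tangent cone. -/
theorem mem_germCone_of_same_side (h : IsPolygonal P V G) {z d d' : Fin 2 → ℝ}
    (hd : d ∈ germCone G z)
    (hs : ∀ i, planeDet (V i) (z - P i) = 0 → 0 < planeDet (V i) d * planeDet (V i) d') :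
    d' ∈ germCone G z := by
  obtain ⟨ε, hε, H⟩ := h.exists_mem_germCone_iff z
  obtain ⟨ε', hε', H'⟩ := h.exists_radius z
  obtain ⟨t, ht, -, htd⟩ := exists_smul_norm_lt (d, d') (lt_min hε hε')
  rw [Prod.smul_mk, Prod.norm_mk, max_lt_iff, lt_min_iff, lt_min_iff] at htd
  rw [← smul_mem_germCone_iff ht, H _ htd.2.1]
  rw [← smul_mem_germCone_iff ht, H _ htd.1.1] at hd
  refine interior_subset (H' _ _ htd.1.2 htd.2.2 (fun i hi => ?_) hd)
  rw [planeDet_smul, planeDet_smul]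
  have := mul_pos (mul_pos ht ht) (hs i hi)
  nlinarith

theorem exists_transversal (h : IsPolygonal P V G) {z : Fin 2 → ℝ} (hz : z ∈ G) {ε : ℝ}
    (hε : 0 < ε) : ∃ d, ‖d‖ < ε ∧ (∀ i, planeDet (V i) d ≠ 0) ∧ z + d ∈ interior G := by
  rw [← h.closure_interior, Metric.mem_closure_iff] at hz
  obtain ⟨w, hw, hwz⟩ := hz ε hε
  have ho : IsOpen {d : Fin 2 → ℝ | ‖d‖ < ε ∧ z + d ∈ interior G} :=
    (isOpen_lt continuous_norm continuous_const).inter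
      (isOpen_interior.preimage (f := fun d => z + d) (by fun_prop))
  obtain ⟨d, ⟨h1, h2⟩, h3⟩ := (dense_planeDet_ne_zero h.ne_zero).inter_open_nonempty _ ho
    ⟨w - z, by rwa [← dist_eq_norm, dist_comm], by simpa using hw⟩
  exact ⟨d, h1, h3, h2⟩

/-- Every point of `G` is the end of a segment in the interior of `G`. -/
theorem accessible (h : IsPolygonal P V G) {z : Fin 2 → ℝ} (hz : z ∈ G) :
    ∃ u, ∀ t ∈ Ioc (0 : ℝ) 1, z + t • u ∈ interior G := by
  obtain ⟨ε, hε, H⟩ := h.exists_radius z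
  obtain ⟨d, h1, h2, h3⟩ := h.exists_transversal hz hε
  refine ⟨d, fun t ht => H d _ h1 ?_ (fun i _ => ?_) (interior_subset h3)⟩
  · rw [norm_smul, Real.norm_of_nonneg ht.1.le]
    nlinarith [norm_nonneg d, ht.1, ht.2]
  · rw [planeDet_smul]
    nlinarith [mul_pos ht.1 (mul_self_pos.2 (h2 i))]

theorem exists_mem_germCone (h : IsPolygonal P V G) {z : Fin 2 → ℝ} (hz : z ∈ G) :
    ∃ d ∈ germCone G z, ∀ i, planeDet (V i) d ≠ 0 := by
  obtain ⟨ε, hε, H⟩ := h.exists_mem_germCone_iff z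
  obtain ⟨d, h1, h2, h3⟩ := h.exists_transversal hz hε
  exact ⟨d, (H d h1).2 (interior_subset h3), h2⟩

end IsPolygonal

/-- The points of `G` whose tangent cone lies, except for its apex, in the open half-plane `ν > 0`.
-/
def pointedAt (G : Set (Fin 2 → ℝ)) (ν : (Fin 2 → ℝ) →L[ℝ] ℝ) : Set (Fin 2 → ℝ) :=
  {z ∈ G | ∀ d ∈ germCone G z, d ≠ 0 → 0 < ν d}

/-- A farthest point of `G` from the origin has a pointed tangent cone. -/
theorem exists_pointedAt_nonempty {G : Set (Fin 2 → ℝ)} (hG : IsCompact G) (hne : G.Nonempty) :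
    ∃ ν, (pointedAt G ν).Nonempty := by
  obtain ⟨z, hz, hmax⟩ := hG.exists_isMaxOn hne
    (f := fun x : Fin 2 → ℝ => x 0 * x 0 + x 1 * x 1) (by fun_prop)
  refine ⟨-(z 0 • ContinuousLinearMap.proj 0 + z 1 • ContinuousLinearMap.proj 1), z, hz, ?_⟩
  intro d hd hd0
  obtain ⟨t, ht, ht0⟩ := ((mem_germCone.1 hd).and self_mem_nhdsWithin).exists
  have ht0 : 0 < t := ht0
  have h1 := hmax ht
  simp only [mem_ofPred_eq, Pi.add_apply, Pi.smul_apply, smul_eq_mul] at h1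
  have h2 : 0 < d 0 * d 0 + d 1 * d 1 := by
    by_contra! h
    refine hd0 ?_
    have h3 : d 0 = 0 := by nlinarith [mul_self_nonneg (d 0), mul_self_nonneg (d 1)]
    have h4 : d 1 = 0 := by nlinarith [mul_self_nonneg (d 0), mul_self_nonneg (d 1)]
    ext i
    fin_cases i <;> simp [h3, h4]
  have h3 : 0 < t * (-(z 0 * d 0 + z 1 * d 1)) := by
    nlinarith [mul_pos (mul_pos ht0 ht0) h2]
  have := pos_of_mul_pos_right h3 ht0.le
  simpa [ContinuousLinearMap.proj] using this

namespace IsPolygonal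

variable {ι : Type*} [Finite ι] {P V : ι → Fin 2 → ℝ} {G : Set (Fin 2 → ℝ)}

/-- A point with a pointed tangent cone is on two edge lines that are not parallel, as otherwise
its tangent cone would contain a line. -/
theorem exists_crossing_lines (h : IsPolygonal P V G) {ν : (Fin 2 → ℝ) →L[ℝ] ℝ} {z : Fin 2 → ℝ}
    (hz : z ∈ pointedAt G ν) : ∃ i j, planeDet (V i) (V j) ≠ 0 ∧
      planeDet (V i) (z - P i) = 0 ∧ planeDet (V j) (z - P j) = 0 := by
  by_contra! hcon
  obtain ⟨v, hv0, hv⟩ : ∃ v : Fin 2 → ℝ, v ≠ 0 ∧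
      ∀ j, planeDet (V j) (z - P j) = 0 → planeDet (V j) v = 0 := by
    by_cases hex : ∃ i, planeDet (V i) (z - P i) = 0
    · obtain ⟨i, hi⟩ := hex
      refine ⟨V i, h.ne_zero i, fun j hj => ?_⟩
      by_contra hne
      exact hcon j i hne hj hi
    · push Not at hex
      exact ⟨![1, 0], fun e => by simpa using congrFun e 0, fun j hj => absurd hj (hex j)⟩
  obtain ⟨d, hd, hdn⟩ := h.exists_mem_germCone hz.1
  -- Moving along `v` does not leave the sides of the lines through `z`, so that the cone contains a
  -- line in the direction of `v` and, in the limit, `v` itself.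
  have hline : ∀ τ : ℝ, d + τ • v ∈ germCone G z := fun τ =>
    h.mem_germCone_of_same_side hd fun i hi => by
      rw [planeDet_add, planeDet_smul, hv i hi, mul_zero, add_zero]
      exact mul_self_pos.2 (hdn i)
  have hnn : ∀ x ∈ germCone G z, 0 ≤ ν x := by
    intro x hx
    by_cases h0 : x = 0
    · simp [h0]
    · exact (hz.2 x hx h0).le
  have hvC : v ∈ germCone G z := by
    have ht : Filter.Tendsto (fun t : ℝ => t • d + v) (nhdsWithin 0 (Ioi 0)) (nhds v) := by
      have : Continuous (fun t : ℝ => t • d + v) := by fun_prop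
      simpa using (this.tendsto 0).mono_left nhdsWithin_le_nhds
    refine (h.isClosed_germCone z).mem_of_tendsto ht ?_
    filter_upwards [self_mem_nhdsWithin] with t ht
    have ht : 0 < t := ht
    have := smul_mem_germCone (hline t⁻¹) ht
    rwa [smul_add, smul_smul, mul_inv_cancel₀ ht.ne', one_smul] at this
  have hpos := hz.2 v hvC hv0
  have := hnn _ (hline (-(ν d + 1) / ν v))
  rw [map_add, map_smul, smul_eq_mul, div_mul_cancel₀ _ hpos.ne'] at this
  linarith

theorem finite_pointedAt (h : IsPolygonal P V G) (ν : (Fin 2 → ℝ) →L[ℝ] ℝ) :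
    (pointedAt G ν).Finite := by
  have hsub : pointedAt G ν ⊆ ⋃ p ∈ {p : ι × ι | planeDet (V p.1) (V p.2) ≠ 0},
      {z | planeDet (V p.1) (z - P p.1) = 0 ∧ planeDet (V p.2) (z - P p.2) = 0} := by
    intro z hz
    obtain ⟨i, j, h1, h2, h3⟩ := h.exists_crossing_lines hz
    exact mem_biUnion (x := (i, j)) h1 ⟨h2, h3⟩
  refine Finite.subset (Finite.biUnion (toFinite _) fun p hp => Subsingleton.finite ?_) hsub
  rintro x ⟨hx1, hx2⟩ y ⟨hy1, hy2⟩
  have e1 : planeDet (V p.1) (x - y) = 0 := by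
    rw [planeDet_sub] at *; linarith
  have e2 : planeDet (V p.2) (x - y) = 0 := by
    rw [planeDet_sub] at *; linarith
  have := planeDet_smul_eq (V p.1) (V p.2) (x - y)
  rw [e1, planeDet_comm (x - y), e2, neg_zero, zero_smul, zero_smul, add_zero] at this
  exact sub_eq_zero.1 ((smul_eq_zero.1 this).resolve_left hp)

end IsPolygonal

/-! ### Maps that preserve the edge directions -/

namespace PreservesSides

variable {ι : Type*} {V : ι → Fin 2 → ℝ}

theorem comp {A B : (Fin 2 → ℝ) → Fin 2 → ℝ} (hA : PreservesSides V A)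
    (hB : PreservesSides V B) : PreservesSides V (A ∘ B) := by
  intro i
  obtain ⟨κ, hκ, h1⟩ := hA i
  obtain ⟨κ', hκ', h2⟩ := hB i
  exact ⟨κ * κ', mul_pos hκ hκ', fun d => by rw [Function.comp, h1, h2, mul_assoc]⟩

theorem pow {A : (Fin 2 → ℝ) ≃L[ℝ] (Fin 2 → ℝ)} (hA : PreservesSides V A) (k : ℕ) :
    PreservesSides V (A ^ k : (Fin 2 → ℝ) ≃L[ℝ] (Fin 2 → ℝ)) := by
  induction k with
  | zero => exact fun i => ⟨1, one_pos, fun d => (one_mul _).symm⟩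
  | succ k ih => rw [pow_succ]; exact ih.comp hA

/-- A linear map with positive eigenvalues in the directions `V i` preserves the sides of these
lines, when there are at least two of them. -/
theorem of_eigenvectors {A : (Fin 2 → ℝ) →L[ℝ] (Fin 2 → ℝ)} {i₀ j₀ : ι}
    (hij : planeDet (V i₀) (V j₀) ≠ 0) (hV : ∀ i, V i ≠ 0)
    (hA : ∀ i, ∃ r : ℝ, 0 < r ∧ A (V i) = r • V i) : PreservesSides V A := by
  intro i
  obtain ⟨j, hj⟩ : ∃ j, planeDet (V i) (V j) ≠ 0 := by
    by_contra! hc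
    obtain ⟨c, hc'⟩ := eq_smul_of_planeDet_eq_zero (hV i) (hc i₀)
    rw [hc', planeDet_comm, planeDet_smul, planeDet_comm, hc j₀] at hij
    simp at hij
  obtain ⟨r, -, hr⟩ := hA i
  obtain ⟨r', hr'0, hr'⟩ := hA j
  refine ⟨r', hr'0, fun d => mul_left_cancel₀ hj ?_⟩
  have := congrArg (fun x => planeDet (V i) (A x)) (planeDet_smul_eq (V i) (V j) d)
  simp only [map_add, map_smul, hr, hr', planeDet_add, planeDet_smul, planeDet_self] at this
  linear_combination this

end PreservesSides

/-- The inverse of a map with eigenvalues larger than one in two directions is contracting. -/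
theorem tendsto_symm_pow {ι : Type*} {V : ι → Fin 2 → ℝ}
    {A : (Fin 2 → ℝ) ≃L[ℝ] (Fin 2 → ℝ)} {i j : ι} (hij : planeDet (V i) (V j) ≠ 0)
    (hA : ∀ i, ∃ r : ℝ, 1 < r ∧ A (V i) = r • V i) (d : Fin 2 → ℝ) :
    Filter.Tendsto (fun k : ℕ => (A ^ k : (Fin 2 → ℝ) ≃L[ℝ] (Fin 2 → ℝ)).symm d) Filter.atTop
      (nhds 0) := by
  have key : ∀ i, ∃ r : ℝ, 1 < r ∧ ∀ k : ℕ,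
      (A ^ k : (Fin 2 → ℝ) ≃L[ℝ] (Fin 2 → ℝ)).symm (V i) = (r⁻¹) ^ k • V i := by
    intro i
    obtain ⟨r, hr1, hr⟩ := hA i
    refine ⟨r, hr1, fun k => ?_⟩
    rw [ContinuousLinearEquiv.symm_apply_eq, map_smul,
      ContinuousLinearEquiv.pow_apply_eq_smul hr, smul_smul, ← mul_pow,
      inv_mul_cancel₀ (by positivity), one_pow, one_smul]
  obtain ⟨r, hr1, hr⟩ := key i
  obtain ⟨r', hr1', hr'⟩ := key j
  have hlim : ∀ {r : ℝ}, 1 < r → Filter.Tendsto (fun k : ℕ => r⁻¹ ^ k) Filter.atTop (nhds 0) :=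
    fun hr => tendsto_pow_atTop_nhds_zero_of_lt_one (by positivity) (inv_lt_one_of_one_lt₀ hr)
  have e : d = (planeDet (V i) (V j))⁻¹ • planeDet d (V j) • V i +
      (planeDet (V i) (V j))⁻¹ • planeDet (V i) d • V j := by
    rw [← smul_add, ← planeDet_smul_eq, smul_smul, inv_mul_cancel₀ hij, one_smul]
  rw [e]
  simp only [map_add, map_smul, hr, hr']
  have l1 := (((hlim hr1).smul_const (V i)).const_smul (planeDet d (V j))).const_smul
    (planeDet (V i) (V j))⁻¹
  have l2 := (((hlim hr1').smul_const (V j)).const_smul (planeDet (V i) d)).const_smul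
    (planeDet (V i) (V j))⁻¹
  simpa using l1.add l2

namespace IsPolygonal

variable {ι : Type*} [Finite ι] {P V : ι → Fin 2 → ℝ} {G S : Set (Fin 2 → ℝ)}
  {A : (Fin 2 → ℝ) ≃L[ℝ] (Fin 2 → ℝ)}

/-- The tangent cone at a point of the blow-up contains the tangent cones of the tiles. -/
theorem exists_tile_pointedAt (h : IsPolygonal P V G) (hA : PreservesSides V A)
    (hS : IsTiling A G S) {ν : (Fin 2 → ℝ) →L[ℝ] ℝ} {z : Fin 2 → ℝ} (hz : z ∈ pointedAt G ν) :
    ∃ x ∈ pointedAt G ν, A z - x ∈ S := by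
  obtain ⟨s, hs, x, hx, e⟩ := hS.subset_translates z hz.1
  refine ⟨x, ⟨hx, fun d hd hd0 => hz.2 d ?_ hd0⟩, by simpa [e] using hs⟩
  have : A.symm d ∈ germCone G z := by
    rw [mem_germCone]
    filter_upwards [mem_germCone.1 hd] with t ht
    obtain ⟨w, hw, ew⟩ := hS.translate_subset s hs _ ht
    have : w = z + t • A.symm d := by
      apply A.injective
      rw [ew, map_add, map_smul, e, A.apply_symm_apply]
      abel
    exact this ▸ hw
  simpa using h.map_mem_germCone (A : (Fin 2 → ℝ) →L[ℝ] (Fin 2 → ℝ)) hA this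

/-- Finitely many points have a tangent cone in the given open half-plane, so that one of them is
at the same place in `G` and in some tile of a blow-up of `G`. -/
theorem exists_periodic_point (h : IsPolygonal P V G) (hA : PreservesSides V A)
    (hS : IsTiling A G S) {ν : (Fin 2 → ℝ) →L[ℝ] ℝ} (hne : (pointedAt G ν).Nonempty) :
    ∃ N > 0, ∃ z ∈ pointedAt G ν, ∃ T,
      IsTiling (A ^ N : (Fin 2 → ℝ) ≃L[ℝ] (Fin 2 → ℝ)) G T ∧
      (A ^ N : (Fin 2 → ℝ) ≃L[ℝ] (Fin 2 → ℝ)) z - z ∈ T := by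
  have : Finite (pointedAt G ν) := (h.finite_pointedAt ν).to_subtype
  choose! f hf hfS using fun z (hz : z ∈ pointedAt G ν) => h.exists_tile_pointedAt hA hS hz
  have hfk : ∀ k, ∀ z ∈ pointedAt G ν, f^[k] z ∈ pointedAt G ν := by
    intro k
    induction k with
    | zero => exact fun z hz => hz
    | succ k ih => exact fun z hz => ih _ (hf z hz)
  have hT : ∀ k : ℕ, ∃ T, IsTiling (A ^ k : (Fin 2 → ℝ) ≃L[ℝ] (Fin 2 → ℝ)) G T ∧
      ∀ z ∈ pointedAt G ν, (A ^ k : (Fin 2 → ℝ) ≃L[ℝ] (Fin 2 → ℝ)) z - f^[k] z ∈ T := by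
    intro k
    induction k with
    | zero => exact ⟨{0}, IsTiling.one G, fun z _ => sub_self z⟩
    | succ k ih =>
      obtain ⟨T, hT, hTf⟩ := ih
      rw [pow_succ]
      refine ⟨_, hT.comp hS, fun z hz => ⟨_, hTf (f z) (hf z hz), _, hfS z hz, ?_⟩⟩
      simp only [map_sub, Function.iterate_succ_apply]
      change _ = (A ^ k : (Fin 2 → ℝ) ≃L[ℝ] (Fin 2 → ℝ)) (A z) - _
      abel
  obtain ⟨z, hz⟩ := hne
  obtain ⟨m, n, hmn, he⟩ := Finite.exists_ne_map_eq_of_infinite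
    fun k : ℕ => (⟨f^[k] z, hfk k z hz⟩ : pointedAt G ν)
  wlog hlt : m < n generalizing m n
  · exact this n m hmn.symm he.symm (lt_of_le_of_ne (not_lt.1 hlt) hmn.symm)
  obtain ⟨T, hT, hTf⟩ := hT (n - m)
  refine ⟨n - m, Nat.sub_pos_of_lt hlt, f^[m] z, hfk m z hz, T, hT, ?_⟩
  have := hTf _ (hfk m z hz)
  have he : f^[m] z = f^[n] z := congrArg Subtype.val he
  rwa [← Function.iterate_add_apply, Nat.sub_add_cancel hlt.le, ← he] at this

end IsPolygonal

/-! ### The cone at a periodic point -/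

/-- A tiling in affine coordinates `p ↦ z + Ψ p`, where `A` maps `z` to `z + s₀`. -/
theorem IsTiling.preimage {E F : Type*} [NormedAddCommGroup E] [NormedSpace ℝ E]
    [NormedAddCommGroup F] [NormedSpace ℝ F] {G T : Set E} {A : E → E} (hT : IsTiling A G T)
    (Ψ : F ≃L[ℝ] E) {z s₀ : E} {B : F → F} (hB : ∀ p, A (z + Ψ p) = z + s₀ + Ψ (B p)) :
    IsTiling B ((fun p => z + Ψ p) ⁻¹' G) ((fun p => s₀ + Ψ p) ⁻¹' T) := by
  have hint : interior ((fun p => z + Ψ p) ⁻¹' G) = (fun p => z + Ψ p) ⁻¹' interior G :=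
    ((Ψ.toHomeomorph.trans (Homeomorph.addLeft z)).preimage_interior G).symm
  refine ⟨hT.finite.preimage (by
    intro a _ b _ e; exact Ψ.injective (add_left_cancel e)), ?_, ?_, ?_⟩
  · intro s hs x hx
    obtain ⟨w, hw, e⟩ := hT.translate_subset _ hs _ hx
    obtain ⟨p, rfl⟩ : ∃ p, w = z + Ψ p := ⟨Ψ.symm (w - z), by simp⟩
    refine ⟨p, hw, Ψ.injective ?_⟩
    rw [hB] at e
    rw [map_add]
    have : z + s₀ + Ψ (B p) = z + s₀ + (Ψ x + Ψ s) := by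
      rw [e]
      simp only
      abel
    exact add_left_cancel this
  · intro p hp
    obtain ⟨s, hs, x, hx, e⟩ := hT.subset_translates _ hp
    refine ⟨Ψ.symm (s - s₀), by simpa using hs, Ψ.symm (x - z), by simpa using hx, Ψ.injective ?_⟩
    rw [hB] at e
    simp only [map_add, ContinuousLinearEquiv.apply_symm_apply]
    have : z + s₀ + Ψ (B p) = z + s₀ + ((x - z) + (s - s₀)) := by
      rw [e]
      abel
    exact add_left_cancel this
  · rw [hint]
    intro s hs t ht x hx y hy e
    refine Ψ.injective (add_left_cancel (hT.eq_of_interior _ hs _ ht _ hx _ hy ?_))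
    have := congrArg Ψ e
    rw [map_add, map_add] at this
    calc z + Ψ x + (s₀ + Ψ s) = z + s₀ + (Ψ x + Ψ s) := by abel
      _ = z + s₀ + (Ψ y + Ψ t) := by rw [this]
      _ = z + Ψ y + (s₀ + Ψ t) := by abel

/-- The linear isomorphism `(x, y) ↦ x • a + y • b` for linearly independent plane vectors. -/
theorem exists_coordinates {a b : Fin 2 → ℝ} (hab : planeDet a b ≠ 0) :
    ∃ Ψ : (ℝ × ℝ) ≃L[ℝ] (Fin 2 → ℝ), ∀ p, Ψ p = p.1 • a + p.2 • b := by
  let f : (ℝ × ℝ) →ₗ[ℝ] (Fin 2 → ℝ) :=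
    (LinearMap.fst ℝ ℝ ℝ).smulRight a + (LinearMap.snd ℝ ℝ ℝ).smulRight b
  have hf : ∀ p, f p = p.1 • a + p.2 • b := fun p => rfl
  have hinj : Function.Injective f := by
    rw [injective_iff_map_eq_zero]
    intro p hp
    rw [hf] at hp
    have h1 := congrArg (planeDet a) hp
    have h2 := congrArg (planeDet b) hp
    rw [planeDet_add, planeDet_smul, planeDet_smul, planeDet_self] at h1 h2
    rw [planeDet_comm b a] at h2
    simp only [planeDet, Pi.zero_apply, mul_zero, sub_zero, zero_add, add_zero, mul_neg,
      neg_eq_zero, mul_eq_zero] at h1 h2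
    exact Prod.ext (h2.resolve_right hab) (h1.resolve_right hab)
  refine ⟨(LinearEquiv.ofInjectiveOfFinrankEq f hinj (by simp)).toContinuousLinearEquiv,
    fun p => ?_⟩
  exact hf p

/-- Coordinates of the plane, the first of which is a given linear functional. -/
theorem exists_adapted_coordinates {ν : (Fin 2 → ℝ) →L[ℝ] ℝ} {w : Fin 2 → ℝ} (hw : ν w = 1) :
    ∃ n, ν n = 0 ∧ planeDet w n ≠ 0 ∧ ∃ μ : (Fin 2 → ℝ) →L[ℝ] ℝ, μ w = 0 ∧ μ n = 1 ∧
      ∀ x, x = ν x • w + μ x • n := by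
  have hν : ∀ x, ν x = x 0 * ν ![1, 0] + x 1 * ν ![0, 1] := by
    intro x
    rw [← smul_eq_mul, ← smul_eq_mul, ← map_smul, ← map_smul, ← map_add]
    congr 1
    ext i
    fin_cases i <;> simp
  set n : Fin 2 → ℝ := ![ν ![0, 1], -ν ![1, 0]] with hn
  have hνn : ν n = 0 := by
    rw [hν, hn]
    simp
    ring
  have hdet : planeDet w n = -1 := by
    rw [← hw, hν w, hn]
    simp [planeDet]
    ring
  set μ : (Fin 2 → ℝ) →L[ℝ] ℝ :=
    w 1 • ContinuousLinearMap.proj 0 - w 0 • ContinuousLinearMap.proj 1 with hμ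
  have hμx : ∀ x, μ x = -planeDet w x := by
    intro x
    simp [hμ, planeDet]
  refine ⟨n, hνn, by rw [hdet]; norm_num, μ, ?_, ?_, fun x => ?_⟩
  · rw [hμx, planeDet_self, neg_zero]
  · rw [hμx, hdet, neg_neg]
  · have h1 := planeDet_smul_eq w n x
    rw [hdet] at h1
    have h2 := congrArg ν h1
    simp only [map_add, map_smul, hνn, hw, smul_eq_mul, mul_one, mul_zero, add_zero] at h2
    rw [← h2] at h1
    rw [hμx]
    have h3 : x = -((-1 : ℝ) • x) := by simp
    conv_lhs => rw [h3, h1]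
    module

namespace IsPolygonal

variable {ι : Type*} [Finite ι] {P V : ι → Fin 2 → ℝ} {G S : Set (Fin 2 → ℝ)}
  {A : (Fin 2 → ℝ) ≃L[ℝ] (Fin 2 → ℝ)}

/-- If a tile of `A G` has the same place with respect to `z` as `G` itself, then `G` is contained
in the tangent cone at `z`. -/
theorem sub_mem_germCone (h : IsPolygonal P V G) (hA : PreservesSides V A)
    (hlim : ∀ d, Filter.Tendsto (fun k : ℕ => (A ^ k : (Fin 2 → ℝ) ≃L[ℝ] (Fin 2 → ℝ)).symm d)
      Filter.atTop (nhds 0))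
    (hS : IsTiling A G S) {z : Fin 2 → ℝ} (hz : A z - z ∈ S) {x : Fin 2 → ℝ} (hx : x ∈ G) :
    x - z ∈ germCone G z := by
  have hk : ∀ k : ℕ, z + (A ^ k : (Fin 2 → ℝ) ≃L[ℝ] (Fin 2 → ℝ)).symm (x - z) ∈ G := by
    intro k
    induction k with
    | zero =>
      change z + (x - z) ∈ G
      simpa using hx
    | succ k ih =>
      obtain ⟨w, hw, e⟩ := hS.translate_subset _ hz _ ih
      rw [pow_succ]
      have : w = z + A.symm ((A ^ k : (Fin 2 → ℝ) ≃L[ℝ] (Fin 2 → ℝ)).symm (x - z)) := by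
        apply A.injective
        rw [e, map_add, A.apply_symm_apply]
        abel
      exact this ▸ hw
  obtain ⟨ε, hε, H⟩ := h.exists_mem_germCone_iff z
  obtain ⟨k, hk'⟩ := ((hlim (x - z)).norm.eventually_lt_const (by simpa using hε)).exists
  have := h.map_mem_germCone
    ((A ^ k : (Fin 2 → ℝ) ≃L[ℝ] (Fin 2 → ℝ)) : (Fin 2 → ℝ) →L[ℝ] (Fin 2 → ℝ))
    (hA.pow k) ((H _ hk').2 (hk k))
  simpa using this

/-- If a pointed tangent cone contains all of `G`, then it has no gaps, because the interior of `G`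
is connected: it is the angle between two rays, which are parallel to edges. -/
theorem exists_germCone_eq (h : IsPolygonal P V G) {ν : (Fin 2 → ℝ) →L[ℝ] ℝ} {z : Fin 2 → ℝ}
    (hz : z ∈ pointedAt G ν) (hG : ∀ x ∈ G, x - z ∈ germCone G z) :
    ∃ a b : Fin 2 → ℝ, planeDet a b ≠ 0 ∧ (∃ i, planeDet (V i) a = 0) ∧
      (∃ i, planeDet (V i) b = 0) ∧
      ∀ x y : ℝ, x • a + y • b ∈ germCone G z ↔ 0 ≤ x ∧ 0 ≤ y := by
  set C := germCone G z with hC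
  have hCcl : IsClosed C := h.isClosed_germCone z
  have h0C : (0 : Fin 2 → ℝ) ∈ C := by simpa using hG z hz.1
  obtain ⟨w, hwC, hνw⟩ : ∃ w ∈ C, ν w = 1 := by
    obtain ⟨d, hd, hdn⟩ := h.exists_mem_germCone hz.1
    obtain ⟨i, -⟩ := h.exists_crossing_lines hz
    have hν : 0 < ν d := hz.2 _ hd (by rintro rfl; exact hdn i (by simp [planeDet]))
    exact ⟨(ν d)⁻¹ • d, smul_mem_germCone hd (inv_pos.2 hν), by simp [hν.ne']⟩
  have hw0 : w ≠ 0 := by rintro rfl; simp at hνw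
  obtain ⟨n, hνn, hdet, μ, hμw, hμn, hdec⟩ := exists_adapted_coordinates hνw
  have hn0 : n ≠ 0 := by rintro rfl; simp at hμn
  -- The cone is described by its section `K` with the line `ν = 1`.
  set K : Set ℝ := {τ | w + τ • n ∈ C} with hK
  have hCK : ∀ x, 0 < ν x → (x ∈ C ↔ μ x / ν x ∈ K) := by
    intro x hx
    rw [← smul_mem_germCone_iff (inv_pos.2 hx)]
    have : (ν x)⁻¹ • x = w + (μ x / ν x) • n := by
      refine (congrArg _ (hdec x)).trans ?_
      rw [smul_add, smul_smul, smul_smul, inv_mul_cancel₀ hx.ne', one_smul, div_eq_inv_mul]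
    rw [this]; rfl
  have hnC : n ∉ C := fun hn => (hz.2 n hn hn0).ne' hνn
  have hUn : ∀ u ∈ interior G, ∀ᶠ t : ℝ in nhdsWithin 0 (Ioi 0), u + t • n ∈ interior G := by
    intro u hu
    have : Filter.Tendsto (fun t : ℝ => u + t • n) (nhdsWithin 0 (Ioi 0)) (nhds u) := by
      have : Continuous (fun t : ℝ => u + t • n) := by fun_prop
      simpa using (this.tendsto 0).mono_left nhdsWithin_le_nhds
    exact this.eventually (isOpen_interior.mem_nhds hu)
  have hUpos : ∀ u ∈ interior G, 0 < ν (u - z) := by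
    intro u hu
    refine hz.2 _ (hG u (interior_subset hu)) fun h0 => hnC ?_
    obtain rfl : u = z := sub_eq_zero.1 h0
    filter_upwards [hUn u hu] with t ht using interior_subset ht
  have hKcl : IsClosed K := hCcl.preimage (f := fun τ : ℝ => w + τ • n) (by fun_prop)
  -- The slopes of the interior points are an interval, which is dense in `K`.
  set I : Set ℝ := (fun u => μ (u - z) / ν (u - z)) '' interior G with hI
  have hIc : IsConnected I := by
    refine h.isConnected_interior.image _ fun u hu => ContinuousAt.continuousWithinAt ?_
    have := (hUpos u hu).ne'
    fun_prop (disch := assumption)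
  have hIK : I ⊆ K := by
    rintro _ ⟨u, hu, rfl⟩
    exact (hCK _ (hUpos u hu)).1 (hG u (interior_subset hu))
  have hKI : K ⊆ closure I := by
    intro τ hτ
    obtain ⟨ε, hε, H⟩ := h.exists_mem_germCone_iff z
    obtain ⟨t, ht, -, htd⟩ := exists_smul_norm_lt (w + τ • n) hε
    have h1 : z + t • (w + τ • n) ∈ closure (interior G) := by
      rw [h.closure_interior, ← H _ htd]
      exact smul_mem_germCone hτ ht
    have h2 : ν (z + t • (w + τ • n) - z) = t := by simp [hνw, hνn]
    have h3 : μ (z + t • (w + τ • n) - z) = t * τ := by simp [hμw, hμn]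
    have h4 : ContinuousAt (fun u => μ (u - z) / ν (u - z)) (z + t • (w + τ • n)) := by
      have : ν (z + t • (w + τ • n) - z) ≠ 0 := by rw [h2]; exact ht.ne'
      fun_prop (disch := assumption)
    have := mem_closure_image h4 h1
    rwa [h2, h3, mul_div_cancel_left₀ _ ht.ne'] at this
  have hKconn : IsConnected K :=
    (Subset.antisymm hKI (closure_minimal hIK hKcl)) ▸ hIc.closure
  have hKbd : Bornology.IsBounded K := by
    obtain ⟨x, ⟨hxC, hx1⟩, hmin⟩ := ((isCompact_sphere (0 : Fin 2 → ℝ) 1).inter_left hCcl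
      ).exists_isMinOn ⟨‖w‖⁻¹ • w, smul_mem_germCone hwC (by positivity), by
        simp [norm_smul, hw0]⟩ ν.continuous.continuousOn
    have hx0 : 0 < ν x := hz.2 x hxC (by rintro rfl; simp at hx1)
    refine isBounded_iff_forall_norm_le.2 ⟨(1 / ν x + ‖w‖) / ‖n‖, fun τ hτ => ?_⟩
    have hτ0 : w + τ • n ≠ 0 := by
      intro h0
      have := congrArg ν h0
      simp [hνw, hνn] at this
    have hpos := norm_pos_iff.2 hτ0
    have h1 : ν x ≤ ν (‖w + τ • n‖⁻¹ • (w + τ • n)) :=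
      hmin ⟨smul_mem_germCone hτ (inv_pos.2 hpos), by
        rw [mem_sphere_zero_iff_norm, norm_smul, norm_inv, norm_norm, inv_mul_cancel₀ hpos.ne']⟩
    rw [map_smul, map_add, map_smul, hνw, hνn, smul_zero, add_zero, smul_eq_mul, mul_one,
      le_inv_comm₀ hx0 hpos] at h1
    rw [le_div_iff₀ (norm_pos_iff.2 hn0), ← norm_smul]
    calc ‖τ • n‖ = ‖(w + τ • n) - w‖ := by rw [add_sub_cancel_left]
      _ ≤ ‖w + τ • n‖ + ‖w‖ := norm_sub_le _ _
      _ ≤ _ := by rw [one_div]; gcongr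
  have hKcomp : IsCompact K := Metric.isCompact_of_isClosed_isBounded hKcl hKbd
  have hKIcc := eq_Icc_of_connected_compact hKconn hKcomp
  set α := sInf K
  set β := sSup K
  have hαβ : α < β := by
    obtain ⟨u, hu⟩ := h.isConnected_interior.nonempty
    obtain ⟨t, htu, ht⟩ := ((hUn u hu).and self_mem_nhdsWithin).exists
    have ht : 0 < t := ht
    have h1 : μ (u - z) / ν (u - z) ∈ Icc α β := hKIcc ▸ hIK ⟨u, hu, rfl⟩
    have h2 : μ (u + t • n - z) / ν (u + t • n - z) ∈ Icc α β := hKIcc ▸ hIK ⟨_, htu, rfl⟩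
    rw [add_sub_right_comm, map_add, map_add, map_smul, map_smul, hνn, hμn, smul_zero, add_zero,
      smul_eq_mul, mul_one, add_div] at h2
    have := div_pos ht (hUpos u hu)
    linarith [h1.1, h2.2]
  -- Next to a direction that is not parallel to an edge, the cone cannot end.
  have hend : ∀ τ ∈ K, (∃ᶠ σ in nhds τ, σ ∉ K) → ∃ i, planeDet (V i) (w + τ • n) = 0 := by
    intro τ hτ hfr
    by_contra! hne
    refine hfr ?_
    have : ∀ᶠ σ in nhds τ, ∀ i,
        0 < planeDet (V i) (w + τ • n) * planeDet (V i) (w + σ • n) := by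
      rw [Filter.eventually_all]
      intro i
      have hc : Continuous fun σ : ℝ =>
        planeDet (V i) (w + τ • n) * planeDet (V i) (w + σ • n) := by fun_prop
      exact hc.continuousAt.eventually (lt_mem_nhds (mul_self_pos.2 (hne i)))
    filter_upwards [this] with σ hσ
    exact not_not.2 (h.mem_germCone_of_same_side hτ fun i _ => hσ i)
  refine ⟨w + α • n, w + β • n, ?_, hend α ?_ ?_, hend β ?_ ?_, fun x y => ?_⟩
  · rw [planeDet_comm, planeDet_add, planeDet_smul, planeDet_comm _ w, planeDet_comm _ n,
      planeDet_add, planeDet_add, planeDet_smul, planeDet_smul, planeDet_self, planeDet_self,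
      planeDet_comm n w]
    intro h0
    refine mul_ne_zero (sub_ne_zero.2 hαβ.ne') hdet ?_
    linarith
  · exact hKIcc ▸ left_mem_Icc.2 hαβ.le
  · exact (frequently_lt_nhds α).mono fun σ hσ hσK => by
      rw [hKIcc] at hσK
      exact absurd hσK.1 (not_le.2 hσ)
  · exact hKIcc ▸ right_mem_Icc.2 hαβ.le
  · exact (frequently_gt_nhds β).mono fun σ hσ hσK => by
      rw [hKIcc] at hσK
      exact absurd hσK.2 (not_le.2 hσ)
  · have hνx : ν (x • (w + α • n) + y • (w + β • n)) = x + y := by simp [hνw, hνn]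
    have hμx : μ (x • (w + α • n) + y • (w + β • n)) = x * α + y * β := by simp [hμw, hμn]
    have hiff : 0 < x + y → (x • (w + α • n) + y • (w + β • n) ∈ C ↔ 0 ≤ x ∧ 0 ≤ y) := by
      intro hpos
      rw [hCK _ (hνx.symm ▸ hpos), hνx, hμx, hKIcc, mem_Icc, le_div_iff₀ hpos, div_le_iff₀ hpos]
      constructor
      · rintro ⟨h1, h2⟩
        constructor
        · by_contra! hx
          nlinarith
        · by_contra! hy
          nlinarith
      · rintro ⟨h1, h2⟩
        constructor <;> nlinarith
    constructor
    · intro hd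
      by_cases h0 : x • (w + α • n) + y • (w + β • n) = 0
      · rw [h0, map_zero] at hνx hμx
        have hy : y * (β - α) = 0 := by linear_combination α * hνx - hμx
        have hy : y = 0 := (mul_eq_zero.1 hy).resolve_right (sub_ne_zero.2 hαβ.ne')
        constructor <;> linarith
      · exact (hiff (hνx ▸ hz.2 _ hd h0)).1 hd
    · rintro ⟨hx, hy⟩
      rcases (add_nonneg hx hy).eq_or_lt with h0 | hpos
      · obtain rfl : x = 0 := by linarith
        obtain rfl : y = 0 := by linarith
        simpa using h0C
      · exact (hiff hpos).2 ⟨hx, hy⟩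

end IsPolygonal

/-! ### From the cone to the parallelogram -/

namespace IsPolygonal

variable {ι : Type*} [Finite ι] {P V : ι → Fin 2 → ℝ} {G S : Set (Fin 2 → ℝ)}
  {A : (Fin 2 → ℝ) ≃L[ℝ] (Fin 2 → ℝ)}

/-- In the coordinates given by the two rays that bound the tangent cone, `G` is a corner tile. -/
theorem isCornerTile_preimage (h : IsPolygonal P V G) (hS : IsTiling A G S) {z : Fin 2 → ℝ}
    (hzS : A z - z ∈ S) {a b : Fin 2 → ℝ} {l m : ℝ} (hl : 1 < l) (hm : 1 < m)
    (hAa : A a = l • a) (hAb : A b = m • b)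
    (hC : ∀ x y : ℝ, x • a + y • b ∈ germCone G z ↔ 0 ≤ x ∧ 0 ≤ y)
    (Ψ : (ℝ × ℝ) ≃L[ℝ] (Fin 2 → ℝ)) (hΨ : ∀ p, Ψ p = p.1 • a + p.2 • b) :
    IsCornerTile l m ((fun p => z + Ψ p) ⁻¹' G) := by
  set Θ : (ℝ × ℝ) ≃ₜ (Fin 2 → ℝ) := Ψ.toHomeomorph.trans (Homeomorph.addLeft z) with hΘ
  have hΘp : ∀ p, Θ p = z + Ψ p := fun p => rfl
  have hint : interior ((fun p => z + Ψ p) ⁻¹' G) = (fun p => z + Ψ p) ⁻¹' interior G :=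
    (Θ.preimage_interior G).symm
  have himg : ∀ X : Set (Fin 2 → ℝ), (fun p => z + Ψ p) ⁻¹' X = Θ.symm '' X :=
    fun X => (Θ.image_symm ▸ rfl)
  set B : (ℝ × ℝ) ≃L[ℝ] (ℝ × ℝ) := (Ψ.trans A).trans Ψ.symm with hB
  have hBp : ∀ p, B p = (l * p.1, m * p.2) := by
    intro p
    change Ψ.symm (A (Ψ p)) = _
    rw [Ψ.symm_apply_eq, hΨ, hΨ, map_add, map_smul, map_smul, hAa, hAb, smul_smul, smul_smul,
      mul_comm l, mul_comm m]
  have hBk : ∀ (k : ℕ) p, (B ^ k : (ℝ × ℝ) ≃L[ℝ] (ℝ × ℝ)) p = (l ^ k * p.1, m ^ k * p.2) := by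
    intro k
    induction k with
    | zero => intro p; simp; rfl
    | succ k ih =>
      intro p
      rw [pow_succ]
      change (B ^ k : (ℝ × ℝ) ≃L[ℝ] (ℝ × ℝ)) (B p) = _
      rw [ih, hBp, ← mul_assoc, ← mul_assoc, ← pow_succ, ← pow_succ]
  have hT : IsTiling B ((fun p => z + Ψ p) ⁻¹' G) ((fun p => (A z - z) + Ψ p) ⁻¹' S) := by
    refine hS.preimage Ψ fun p => ?_
    have : Ψ (B p) = A (Ψ p) := Ψ.apply_symm_apply _
    rw [this, map_add]
    abel
  refine ⟨hl, hm, ?_, ?_, ?_, ?_, ?_, fun k => ?_⟩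
  · rw [himg]
    exact h.isCompact.image Θ.symm.continuous
  · rw [hint]
    refine (Θ.preimage_closure (interior G)).symm.trans ?_
    rw [h.closure_interior]
    rfl
  · rw [hint, himg]
    exact h.isConnected_interior.image _ Θ.symm.continuous.continuousOn
  · intro p hp
    obtain ⟨u, hu⟩ := h.accessible hp
    refine ⟨Ψ.symm u, fun t ht => ?_⟩
    rw [hint, mem_preimage, map_add, map_smul, Ψ.apply_symm_apply, ← add_assoc]
    exact hu t ht
  · obtain ⟨ε, hε, H⟩ := h.exists_mem_germCone_iff z
    have hev : ∀ᶠ p in nhds (0 : ℝ × ℝ), ‖Ψ p‖ < ε := by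
      have hc : Continuous fun p => ‖Ψ p‖ := by fun_prop
      exact hc.continuousAt.eventually (gt_mem_nhds (by simpa using hε))
    obtain ⟨δ, hδ, H'⟩ := Metric.eventually_nhds_iff.1 hev
    refine ⟨δ, hδ, fun p hp => ?_⟩
    rw [mem_preimage, ← H _ (H' (by simpa using hp)), hΨ, hC]
  · obtain ⟨T, h0, hT⟩ := hT.pow k
    refine ⟨T, h0 (by simpa using hzS), ?_⟩
    rwa [show (fun p : ℝ × ℝ => (l ^ k * p.1, m ^ k * p.2)) =
      (B ^ k : (ℝ × ℝ) ≃L[ℝ] (ℝ × ℝ)) from funext fun p => (hBk k p).symm]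

/-- A polygonal set that is tiled in the blow-up along its edge directions is a parallelogram. -/
theorem isParallelogram (h : IsPolygonal P V G) (hS : IsTiling A G S)
    (hA : ∀ i, ∃ r : ℝ, 1 < r ∧ A (V i) = r • V i) : IsParallelogram G := by
  obtain ⟨ν, hν⟩ := exists_pointedAt_nonempty h.isCompact
    (h.isConnected_interior.nonempty.mono interior_subset)
  obtain ⟨i, j, hij, -⟩ := h.exists_crossing_lines hν.some_mem
  have hsides : PreservesSides V A :=
    PreservesSides.of_eigenvectors (A := (A : (Fin 2 → ℝ) →L[ℝ] (Fin 2 → ℝ))) hij h.ne_zero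
      fun i => (hA i).imp fun r hr => ⟨zero_lt_one.trans hr.1, hr.2⟩
  obtain ⟨N, hN, z, hz, T, hT, hzT⟩ := h.exists_periodic_point hsides hS hν
  have hAN : ∀ i, ∃ r : ℝ, 1 < r ∧
      (A ^ N : (Fin 2 → ℝ) ≃L[ℝ] (Fin 2 → ℝ)) (V i) = r • V i := by
    intro i
    obtain ⟨r, hr1, hr⟩ := hA i
    exact ⟨r ^ N, one_lt_pow₀ hr1 hN.ne', ContinuousLinearEquiv.pow_apply_eq_smul hr N⟩
  have hcone := fun x hx => h.sub_mem_germCone (hsides.pow N) (tendsto_symm_pow hij hAN) hT hzT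
    (x := x) hx
  obtain ⟨a, b, hab, ⟨i, hi⟩, ⟨j, hj⟩, hC⟩ := h.exists_germCone_eq hz hcone
  have heig : ∀ {i} {a : Fin 2 → ℝ}, planeDet (V i) a = 0 → ∃ r : ℝ, 1 < r ∧
      (A ^ N : (Fin 2 → ℝ) ≃L[ℝ] (Fin 2 → ℝ)) a = r • a := by
    intro i a hia
    obtain ⟨c, rfl⟩ := eq_smul_of_planeDet_eq_zero (h.ne_zero i) hia
    obtain ⟨r, hr1, hr⟩ := hAN i
    exact ⟨r, hr1, by rw [map_smul, hr, smul_comm]⟩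
  obtain ⟨l, hl, hla⟩ := heig hi
  obtain ⟨m, hm, hmb⟩ := heig hj
  obtain ⟨Ψ, hΨ⟩ := exists_coordinates hab
  obtain ⟨f, g, hf, hg, hbox⟩ :=
    (h.isCornerTile_preimage hT hzT hl hm hla hmb hC Ψ hΨ).exists_eq_prod
  refine ⟨z, f • a, g • b, ?_, ?_⟩
  · rw [LinearIndependent.pair_iff]
    intro s t hst
    have := congrArg Ψ.symm (show Ψ (s * f, t * g) = Ψ 0 by
      rw [hΨ, map_zero, ← hst, smul_smul, smul_smul])
    rw [Ψ.symm_apply_apply, Ψ.symm_apply_apply] at this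
    simpa [Prod.ext_iff, hf.ne', hg.ne'] using this
  · ext x
    have hx : x ∈ G ↔ Ψ.symm (x - z) ∈ Icc 0 f ×ˢ Icc 0 g := by
      rw [← hbox]; simp
    rw [hx, mem_image]
    constructor
    · rintro ⟨⟨h1, h2⟩, h3, h4⟩
      refine ⟨x - z, ?_, by abel⟩
      rw [mem_parallelepiped_iff]
      refine ⟨![(Ψ.symm (x - z)).1 / f, (Ψ.symm (x - z)).2 / g], ⟨?_, ?_⟩, ?_⟩
      · intro i
        fin_cases i
        · exact div_nonneg h1 hf.le
        · exact div_nonneg h3 hg.le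
      · intro i
        fin_cases i
        · exact div_le_one_of_le₀ h2 hf.le
        · exact div_le_one_of_le₀ h4 hg.le
      · rw [Fin.sum_univ_two]
        simp only [Matrix.cons_val_zero, Matrix.cons_val_one, smul_smul, div_mul_cancel₀ _ hf.ne',
          div_mul_cancel₀ _ hg.ne']
        rw [← hΨ, Ψ.apply_symm_apply]
    · rintro ⟨y, hy, rfl⟩
      rw [mem_parallelepiped_iff] at hy
      obtain ⟨t, ⟨ht0, ht1⟩, rfl⟩ := hy
      have : Ψ.symm (z + ∑ i, t i • ![f • a, g • b] i - z) = (t 0 * f, t 1 * g) := by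
        rw [Ψ.symm_apply_eq, hΨ, Fin.sum_univ_two]
        simp [smul_smul]
      rw [this]
      have h00 := ht0 0
      have h01 := ht0 1
      have h10 := ht1 0
      have h11 := ht1 1
      simp only [Pi.zero_apply, Pi.one_apply] at h00 h01 h10 h11
      exact ⟨⟨by positivity, by nlinarith⟩, by positivity, by nlinarith⟩

end IsPolygonal

/-! ### Attractors -/

theorem finite_of_forall_le_dist {E : Type*} [MetricSpace E] {S K : Set E} (hK : IsCompact K)
    (hSK : S ⊆ K) {r : ℝ} (hr : 0 < r) (hS : ∀ s ∈ S, ∀ t ∈ S, s ≠ t → r ≤ dist s t) :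
    S.Finite := by
  by_contra hinf
  obtain ⟨x, -, hx⟩ := Set.Infinite.exists_accPt_of_subset_isCompact hinf hK hSK
  rw [accPt_iff_nhds] at hx
  obtain ⟨y, ⟨hy, hyS⟩, hyx⟩ := hx _ (Metric.ball_mem_nhds x (half_pos hr))
  obtain ⟨y', ⟨hy', hyS'⟩, hyx'⟩ := hx _ (Metric.ball_mem_nhds x
    (lt_min (half_pos hr) (dist_pos.2 hyx)))
  rw [Metric.mem_ball] at hy hy'
  rw [lt_min_iff] at hy'
  have hne : y ≠ y' := by
    rintro rfl
    exact lt_irrefl _ hy'.2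
  have := hS y hyS y' hyS' hne
  linarith [dist_triangle_right y y' x, hy'.1]

theorem IsExpanding.isUnit {d : ℕ} {M : Matrix (Fin d) (Fin d) ℝ} (hM : IsExpanding M) :
    IsUnit M.det := by
  have h0 : (0 : ℂ) ∉ spectrum ℂ (M.map (algebraMap ℝ ℂ)) := fun h => by
    have := hM 0 h
    simp at this
    linarith
  rw [spectrum.zero_notMem_iff, Matrix.isUnit_iff_isUnit_det] at h0
  have h1 : (M.map (algebraMap ℝ ℂ)).det = algebraMap ℝ ℂ M.det :=
    ((algebraMap ℝ ℂ).map_det M).symm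
  rw [h1] at h0
  simpa using h0

/-- The blow-up of an attractor by its expanding matrix is tiled by translates. -/
theorem IsAttractor.exists_isTiling {d : ℕ} {G : Set (Fin d → ℝ)} (hG : IsAttractor G)
    (hint : (interior G).Nonempty) : ∃ M : Matrix (Fin d) (Fin d) ℝ, IsExpanding M ∧
      ∃ A : (Fin d → ℝ) ≃L[ℝ] (Fin d → ℝ), (∀ x, A x = M.mulVec x) ∧ ∃ S, IsTiling A G S := by
  obtain ⟨⟨x₀, hx₀⟩, hc, M, S, hM, hcov, hdis⟩ := hG
  have hu := hM.isUnit
  set A : (Fin d → ℝ) ≃L[ℝ] (Fin d → ℝ) := (Matrix.toLin'OfInv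
    (Matrix.nonsing_inv_mul M hu) (Matrix.mul_nonsing_inv M hu)).toContinuousLinearEquiv with hA
  have hAx : ∀ x, A x = M.mulVec x := fun x => Matrix.toLin'_apply M x
  have hAs : ∀ x, M⁻¹.mulVec x = A.symm x := fun x => by
    rw [← A.symm_apply_apply (M⁻¹.mulVec x), hAx, Matrix.mulVec_mulVec,
      Matrix.mul_nonsing_inv M hu, Matrix.one_mulVec]
  have hcopy : ∀ s, contractedCopy M G s = (fun x => A.symm (x + s)) '' G := by
    intro s
    simp [contractedCopy, hAs]
  have hsub : ∀ s ∈ S, ∀ x ∈ G, A.symm (x + s) ∈ G := by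
    intro s hs x hx
    rw [hcov]
    exact mem_biUnion hs (by rw [hcopy]; exact ⟨x, hx, rfl⟩)
  have hopen : ∀ s x, x ∈ interior G → A.symm (x + s) ∈ interior (contractedCopy M G s) := by
    intro s x hx
    have ho : IsOpen ((fun z => A z - s) ⁻¹' interior G) :=
      isOpen_interior.preimage (by fun_prop)
    refine interior_maximal ?_ ho (by simpa using hx)
    intro z hz
    rw [hcopy]
    exact ⟨A z - s, interior_subset hz, by simp⟩
  have hdisj : ∀ s ∈ S, ∀ t ∈ S, ∀ x ∈ interior G, ∀ y ∈ interior G, x + s = y + t → s = t := by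
    intro s hs t ht x hx y hy e
    by_contra hst
    have h1 := hopen s x hx
    have h2 := hopen t y hy
    rw [← e] at h2
    have h3 : (interior (contractedCopy M G s ∩ contractedCopy M G t)).Nonempty := by
      rw [interior_inter]
      exact ⟨_, h1, h2⟩
    exact (Measure.measure_pos_of_nonempty_interior volume h3).ne' (hdis s hs t ht hst)
  refine ⟨M, hM, A, hAx, S, ?_, ?_, ?_, hdisj⟩
  · obtain ⟨u, hu⟩ := hint
    obtain ⟨r, hr, hball⟩ := Metric.isOpen_iff.1 isOpen_interior u hu
    have hK : IsCompact ((fun p : (Fin d → ℝ) × (Fin d → ℝ) => A p.1 - p.2) '' (G ×ˢ G)) :=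
      (hc.prod hc).image (by fun_prop)
    refine finite_of_forall_le_dist hK (fun s hs => ?_) hr fun s hs t ht hst => ?_
    · exact ⟨(A.symm (x₀ + s), x₀), ⟨hsub s hs x₀ hx₀, hx₀⟩, by simp⟩
    · by_contra! hlt
      refine hst (hdisj s hs t ht u hu (u + (s - t)) (hball ?_) (by abel))
      simpa [dist_eq_norm] using hlt
  · exact fun s hs x hx => ⟨_, hsub s hs x hx, by simp⟩
  · intro z hz
    rw [hcov] at hz
    obtain ⟨s, hs, hz⟩ := mem_iUnion₂.1 hz
    rw [hcopy] at hz
    obtain ⟨x, hx, rfl⟩ := hz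
    exact ⟨s, hs, x, hx, by simp⟩

/-- Real eigenvalues of powers of an expanding matrix are larger than one in absolute value. -/
theorem IsExpanding.one_lt_abs {d : ℕ} {M : Matrix (Fin d) (Fin d) ℝ} (hM : IsExpanding M) {N : ℕ}
    (hN : 0 < N) {v : Fin d → ℝ} (hv : v ≠ 0) {r : ℝ} (hr : (M ^ N).mulVec v = r • v) :
    1 < |r| := by
  set f := algebraMap ℝ ℂ with hf
  have hmem : (r : ℂ) ∈ spectrum ℂ ((M.map f) ^ N) := by
    rw [spectrum.mem_iff]
    intro hu
    have hpow : (M.map f) ^ N = (M ^ N).map f := (map_pow f.mapMatrix M N).symm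
    have h0 : (algebraMap ℂ (Matrix (Fin d) (Fin d) ℂ) r - (M.map f) ^ N).mulVec (f ∘ v) = 0 := by
      ext i
      rw [Matrix.sub_mulVec, Pi.sub_apply, hpow, ← RingHom.map_mulVec, hr,
        Algebra.algebraMap_eq_smul_one, Matrix.smul_mulVec, Matrix.one_mulVec]
      simp [hf]
    have h1 : f ∘ v = 0 := Matrix.mulVec_injective_of_isUnit hu (by rw [h0, Matrix.mulVec_zero])
    refine hv (funext fun i => ?_)
    have := congrFun h1 i
    simpa [hf] using this
  rw [spectrum.map_pow_of_pos _ hN] at hmem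
  obtain ⟨z, hz, hzr⟩ := hmem
  have h1 := one_lt_pow₀ (hM z hz) hN.ne'
  simp only at hzr
  rwa [← norm_pow, hzr, Complex.norm_real, Real.norm_eq_abs] at h1

namespace IsPolygonal

variable {ι : Type*} [Finite ι] {P V : ι → Fin 2 → ℝ} {G S : Set (Fin 2 → ℝ)}
  {A : (Fin 2 → ℝ) ≃L[ℝ] (Fin 2 → ℝ)}

/-- The images of the edges are covered by finitely many translates of edges, so that each of them
is parallel to an edge. -/
theorem exists_parallel (h : IsPolygonal P V G) (hS : IsTiling A G S) (i : ι) :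
    ∃ j, ∃ c : ℝ, A (V i) = c • V j := by
  have hmem : ∀ t ∈ Icc (0 : ℝ) 1, ∃ q : (Fin 2 → ℝ) × ι, q.1 ∈ S ∧
      ∃ r : ℝ, A (P i + t • V i) = P q.2 + r • V q.2 + q.1 := by
    intro t ht
    have hfr : P i + t • V i ∈ frontier G := by
      rw [h.frontier_eq]
      refine mem_iUnion.2 ⟨i, ?_⟩
      rw [segment_eq_image']
      exact ⟨t, ht, by simp⟩
    obtain ⟨s, hs, x, hx, e⟩ := hS.subset_translates _ (h.isClosed.frontier_subset hfr)
    have hxf : x ∈ frontier G := by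
      rw [h.isClosed.frontier_eq]
      exact ⟨hx, fun hxi => hfr.2 (hS.mem_interior hs hxi e)⟩
    rw [h.frontier_eq] at hxf
    obtain ⟨j, hj⟩ := mem_iUnion.1 hxf
    rw [segment_eq_image'] at hj
    obtain ⟨r, -, hr⟩ := hj
    refine ⟨(s, j), hs, r, ?_⟩
    rw [e, ← hr]
    simp
  have : Nonempty ι := ⟨i⟩
  choose! q hqS hq using hmem
  have hfin : (S ×ˢ (univ : Set ι)).Finite := hS.finite.prod finite_univ
  obtain ⟨t, ht, t', ht', hne, heq⟩ := (Icc_infinite (zero_lt_one' ℝ)).exists_ne_map_eq_of_mapsTo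
    (fun t ht => (⟨hqS t ht, mem_univ _⟩ : q t ∈ S ×ˢ univ)) hfin
  obtain ⟨r, hr⟩ := hq t ht
  obtain ⟨r', hr'⟩ := hq t' ht'
  rw [← heq] at hr'
  refine ⟨(q t).2, (t - t')⁻¹ * (r - r'), ?_⟩
  have h1 : (t - t') • A (V i) = (r - r') • V (q t).2 := by
    have := congrArg₂ (· - ·) hr hr'
    simp only [map_add, map_smul] at this
    rw [sub_smul, sub_smul]
    calc t • A (V i) - t' • A (V i) = (A (P i) + t • A (V i)) - (A (P i) + t' • A (V i)) := by abel
      _ = _ := this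
      _ = _ := by abel
  rw [mul_smul, ← h1, smul_smul, inv_mul_cancel₀ (sub_ne_zero.2 hne), one_smul]

end IsPolygonal

/-- A linear map that permutes finitely many lines has a power that fixes each of them, and the
square of this power has positive eigenvalues. -/
theorem exists_pow_eigenvector {ι E : Type*} [Finite ι] [NormedAddCommGroup E] [NormedSpace ℝ E]
    {A : E ≃L[ℝ] E} {V : ι → E} (hV : ∀ i, V i ≠ 0)
    (hA : ∀ i, ∃ j, ∃ c : ℝ, A (V i) = c • V j) :
    ∃ N > 0, ∀ i, ∃ r : ℝ, 0 < r ∧ (A ^ N : E ≃L[ℝ] E) (V i) = r • V i := by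
  choose g c hg using hA
  have hgk : ∀ (k : ℕ) i, ∃ c : ℝ, (A ^ k : E ≃L[ℝ] E) (V i) = c • V (g^[k] i) := by
    intro k
    induction k with
    | zero => exact fun i => ⟨1, (one_smul _ _).symm⟩
    | succ k ih =>
      intro i
      obtain ⟨c', hc'⟩ := ih (g i)
      refine ⟨c i * c', ?_⟩
      rw [pow_succ]
      change (A ^ k : E ≃L[ℝ] E) (A (V i)) = _
      rw [hg, map_smul, hc', smul_smul, Function.iterate_succ_apply]
  have hne : ∀ (k : ℕ) i, (A ^ k : E ≃L[ℝ] E) (V i) ≠ 0 := fun k i h0 =>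
    hV i ((A ^ k : E ≃L[ℝ] E).map_eq_zero_iff.1 h0)
  -- Two iterates of `A` send `V i` to parallel vectors, and the smaller one can be cancelled.
  have hloc : ∀ i, ∃ n > 0, ∃ r : ℝ, (A ^ n : E ≃L[ℝ] E) (V i) = r • V i := by
    intro i
    obtain ⟨m, n, hmn, he⟩ := Finite.exists_ne_map_eq_of_infinite fun k : ℕ => g^[k] i
    wlog hlt : m < n generalizing m n
    · exact this n m hmn.symm he.symm (lt_of_le_of_ne (not_lt.1 hlt) hmn.symm)
    obtain ⟨a, ha⟩ := hgk m i
    obtain ⟨b, hb⟩ := hgk n i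
    have ha0 : a ≠ 0 := by
      rintro rfl
      exact hne m i (by rw [ha, zero_smul])
    refine ⟨n - m, Nat.sub_pos_of_lt hlt, b * a⁻¹, (A ^ m : E ≃L[ℝ] E).injective ?_⟩
    rw [map_smul, ha, smul_smul, mul_assoc, inv_mul_cancel₀ ha0, mul_one, he, ← hb]
    change (A ^ m * A ^ (n - m) : E ≃L[ℝ] E) (V i) = _
    rw [← pow_add, Nat.add_sub_cancel' hlt.le]
  choose n hn r hr using hloc
  have := Fintype.ofFinite ι
  refine ⟨2 * ∏ i, n i, by
    have := Finset.prod_pos fun i (_ : i ∈ Finset.univ) => hn i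
    omega, fun i => ?_⟩
  obtain ⟨k, hk⟩ := Finset.dvd_prod_of_mem n (Finset.mem_univ i)
  have e : 2 * ∏ i, n i = n i * (k * 2) := by rw [hk]; ring
  have hr0 : r i ≠ 0 := by
    intro h0
    exact hne (n i) i (by rw [hr, h0, zero_smul])
  refine ⟨((r i) ^ k) ^ 2, by positivity, ?_⟩
  rw [e, pow_mul, ContinuousLinearEquiv.pow_apply_eq_smul (hr i), pow_mul]

theorem IsPlanePolygon.exists_isPolygonal {G : Set (Fin 2 → ℝ)} (hG : IsPlanePolygon G) :
    ∃ (n : ℕ) (P V : Fin n → Fin 2 → ℝ), IsPolygonal P V G := by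
  obtain ⟨n, p, hp, hfr⟩ := hG.boundary
  refine ⟨n, p, fun i => p (finRotate n i) - p i, hG.compact, hG.closure_interior,
    hG.connected_interior, fun i => sub_ne_zero.2 (hp.nondegenerate i).symm, ?_⟩
  rw [hfr]
  simp only [Polygon.boundary, Polygon.edgeSet, affineSegment_eq_segment, add_sub_cancel]

theorem mainTheorem2 (G : Set (Fin 2 → ℝ)) (hpoly : IsPlanePolygon G) (hattr : IsAttractor G) :
    IsParallelogram G := by
  obtain ⟨n, P, V, h⟩ := hpoly.exists_isPolygonal
  obtain ⟨M, hM, A, hA, S, hS⟩ := hattr.exists_isTiling h.isConnected_interior.nonempty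
  obtain ⟨N, hN, hr⟩ := exists_pow_eigenvector h.ne_zero (h.exists_parallel hS)
  obtain ⟨T, -, hT⟩ := hS.pow N
  have hAM : ∀ (k : ℕ) x, (A ^ k : (Fin 2 → ℝ) ≃L[ℝ] (Fin 2 → ℝ)) x = (M ^ k).mulVec x := by
    intro k
    induction k with
    | zero => intro x; rw [pow_zero, pow_zero, Matrix.one_mulVec]; rfl
    | succ k ih =>
      intro x
      rw [pow_succ, pow_succ, ← Matrix.mulVec_mulVec, ← hA, ← ih]
      rfl
  refine h.isParallelogram hT fun i => ?_
  obtain ⟨r, hr0, hr⟩ := hr i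
  refine ⟨r, ?_, hr⟩
  have := hM.one_lt_abs hN (h.ne_zero i) (by rw [← hAM, hr])
  rwa [abs_of_pos hr0] at this
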